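/- **Setting.** Two sellers offer an item to a unit-demand buyer. Her values $v_1,v_2$ are i.i.d. from a distribution $F$ with a density $f$ supported in $[V,V+1]$, where $V\ge 2$. Assume that $f$ is differentiable on some interval $(V,V+\varepsilon)$ and that the limits $f(V^+)=\lim_{s\downarrow V}f(s)$ and $f'(V^+)=\lim_{s\downarrow V}f'(s)$ exist and are finite. The sellers post visible prices. A prominence mechanism maps the price profile to the probabilities $x_1,x_2\ge 0$, $x_1+x_2\le 1$, with which each seller is made prominent. Inspecting the prominent seller costs $0$, inspecting any other seller costs $c$. The buyer then follows Weitzman's index policy: seller $i$ with price $p_i$ and inspection cost $c_i$ has the index $\theta_i$ solving $\mathbb E\big[([v-p_i]^+-\theta_i)^+\big]=c_i$ (the least solution if $c_i=0$); she inspects sellers with nonnegative index in decreasing order of index (a fair coin breaks ties), stops when the utility $v_i-p_i$ found is at least the next index, and buys from the inspected seller with the highest utility if that is nonnegative. Let $Y_i,Z_i$ be the indicators of buying from, and of inspecting, seller $i$. The consumer surplus is $\mathbb E[\sum_i Y_i(v_i-p_i)-\sum_i c_iZ_i]$, the social welfare is $\mathbb E[\sum_i (Y_iv_i-c_iZ_i)]$,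 and a seller's revenue is their price times the probability that the buyer buys from them. A mechanism is standard if it is anonymous and, at every symmetric pure Nash equilibrium (of the sellers' pricing game), always makes some seller prominent. A price $t$ is implementable at cost $c$ if $(t,t)$ is an equilibrium of some standard mechanism. Let $\theta_0(c)$ solve $\mathbb E[(v-\theta)^+]=c$ (the least solution if $c=0$), let $\bar c$ be the cost with $\theta_0(\bar c)=V$, and for $c\in[0,\bar c]$ and $x>0$ let $$\mathcal D_c(x)=\int_V^{\theta_0(c)-x}(1-F(v+x))\,dF(v)\ \text{ if } x<\theta_0(c)-V,\qquad \mathcal D_c(x)=0\ \text{ otherwise},\qquad t^*(c)=\sup_{x>0}\frac{x\,\mathcal D_c(x)}{\frac12-\mathcal D_c(x)} .$$ Let $SW(c)$ and $CS(c)$ be the social welfare and the consumer surplus when both sellers post the price $t^*(c)$ and each is prominent with probability $\frac12$. **Theorem.** Suppose that $f(V^+)^2<\frac1{13}f'(V^+)$. Then: 1. $CS(c)=SW(c)-t^*(c)$ for all $c\in[0,\bar c]$. For every $c\in(0,\bar c)$, no symmetric equilibrium of a standard mechanism gives a consumer surplus above $CS(c)$. For all $c<\bar c$ close enough to $\bar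 c$, $t^*(c)$ is the lowest implementable price and $CS(c)$ is the highest consumer surplus achieved at a symmetric equilibrium of a standard mechanism. 2. $CS(c)\to\mathbb E[v]$ as $c\to\bar c^-$, and $CS(c)\to CS(0)$ as $c\to0^+$. 3. $CS(c)>\mathbb E[v]$ for all $c<\bar c$ close enough to $\bar c$. 4. $CS$ attains its maximum over $[0,\bar c]$ at some cost $c'<\bar c$, and $CS(c')>\mathbb E[v]$. So the consumer surplus is not maximized as $c\to\bar c$: some costs in $(0,\bar c)$ are strictly better. -/

import Mathlib

open MeasureTheory ProbabilityTheory Set Filter Topology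

namespace ProminenceMarket

noncomputable section

/-! Two sellers, indexed by `Fin 2`; the other seller than `i` is `i.rev`.  Values are i.i.d. with
law `μ`; `p` is the profile of prices and `k` the profile of inspection costs. -/

/-- The joint law of the buyer's values for the two sellers. -/
def valueLaw (μ : Measure ℝ) : Measure (Fin 2 → ℝ) := Measure.pi fun _ => μ

/-- The Weitzman index of a seller with price `p` and inspection cost `k`: the `θ` solving
`E[([v - p]⁺ - θ)⁺] = k`.  The left side is continuous and nonincreasing in `θ`, and strictly
decreasing where it is positive, so for `k > 0` this infimum is the unique solution; for `k = 0`
it is the least solution. -/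
def weitzmanIndex (μ : Measure ℝ) (p k : ℝ) : ℝ :=
  sInf {θ : ℝ | ∫ v, max (max (v - p) 0 - θ) 0 ∂μ ≤ k}

/-- `θ₀(c)`: the solution of `E[(v - θ)⁺] = c` (the least one for `c = 0`). -/
def theta0 (μ : Measure ℝ) (c : ℝ) : ℝ :=
  sInf {θ : ℝ | ∫ v, max (v - θ) 0 ∂μ ≤ c}

/-- `c̄`: the cost for which `V` solves `E[(v - θ)⁺] = c`. -/
def cBar (μ : Measure ℝ) (V : ℝ) : ℝ := ∫ v, max (v - V) 0 ∂μ

section Search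

variable (θ p v : Fin 2 → ℝ) (a i : Fin 2)

/-- In the index policy with indices `θ`, where `a` is a seller with the highest index (and comes
first in the order of search), seller `i` is inspected if their index is nonnegative and either
they come first, or the utility found at the first seller is below the index of `i`. -/
def Inspects : Prop := 0 ≤ θ i ∧ (i = a ∨ v a - p a < θ i)

/-- The buyer purchases from `i`: they are inspected, offer nonnegative utility, and offer the
highest utility among the inspected sellers (an exact tie goes to the first one). -/
def Buys : Prop :=
  Inspects θ p v a i ∧ 0 ≤ v i - p i ∧
    ∀ j, j ≠ i → Inspects θ p v a j →
      v j - p j < v i - p i ∨ (v j - p j = v i - p i ∧ i = a)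

/-- The probability that `a` comes first in the order of search: a fair coin decides if the two
indices are equal. -/
def firstProb : ℝ :=
  if θ a.rev < θ a then 1 else if θ a.rev = θ a then 1 / 2 else 0

end Search

/-- The indices of the sellers. -/
def indices (μ : Measure ℝ) (p k : Fin 2 → ℝ) : Fin 2 → ℝ :=
  fun i => weitzmanIndex μ (p i) (k i)

/-- The probability that the buyer purchases from `i`, at prices `p` and inspection costs `k`. -/
def purchaseProb (μ : Measure ℝ) (p k : Fin 2 → ℝ) (i : Fin 2) : ℝ :=
  ∑ a, firstProb (indices μ p k) a * (valueLaw μ).real {v | Buys (indices μ p k) p v a i}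

/-- The buyer's expected utility `E[∑ Yᵢ (vᵢ - pᵢ)] - E[∑ kᵢ Zᵢ]` at prices `p` and inspection
costs `k`. -/
def buyerUtility (μ : Measure ℝ) (p k : Fin 2 → ℝ) : ℝ :=
  ∑ a, firstProb (indices μ p k) a *
    ∫ v, ∑ i, ({v | Buys (indices μ p k) p v a i}.indicator (fun v => v i - p i) v
      - {v | Inspects (indices μ p k) p v a i}.indicator (fun _ => k i) v) ∂(valueLaw μ)

/-- The expected welfare `E[∑ (vᵢ Yᵢ - kᵢ Zᵢ)]` at prices `p` and inspection costs `k`. -/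
def expectedWelfare (μ : Measure ℝ) (p k : Fin 2 → ℝ) : ℝ :=
  ∑ a, firstProb (indices μ p k) a *
    ∫ v, ∑ i, ({v | Buys (indices μ p k) p v a i}.indicator (fun v => v i) v
      - {v | Inspects (indices μ p k) p v a i}.indicator (fun _ => k i) v) ∂(valueLaw μ)

/-- The inspection costs when seller `w` is prominent: `0` for `w` and `c` for the other. -/
def prominentCosts (c : ℝ) (w : Fin 2) : Fin 2 → ℝ := fun i => if i = w then 0 else c

/-- The expectation of a quantity `g` that depends on the inspection costs, when seller `w` is
prominent with probability `x w` and no seller is with the remaining probability. -/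
def average (c : ℝ) (x : Fin 2 → ℝ) (g : (Fin 2 → ℝ) → ℝ) : ℝ :=
  ∑ w, x w * g (prominentCosts c w) + (1 - ∑ w, x w) * g (fun _ => c)

/-- A prominence mechanism: the probability with which each seller wins prominence, as a
function of the prices. -/
structure ProminenceMechanism where
  alloc : (Fin 2 → ℝ) → Fin 2 → ℝ
  alloc_nonneg : ∀ p i, 0 ≤ alloc p i
  sum_alloc_le_one : ∀ p, ∑ i, alloc p i ≤ 1

/-- The expected revenue of seller `i`. -/
def revenue (μ : Measure ℝ) (c : ℝ) (M : ProminenceMechanism) (p : Fin 2 → ℝ) (i : Fin 2) : ℝ :=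
  p i * average c (M.alloc p) fun k => purchaseProb μ p k i

/-- Pure Nash equilibrium of the pricing game under the mechanism `M`. -/
def IsEquilibrium (μ : Measure ℝ) (c : ℝ) (M : ProminenceMechanism) (p : Fin 2 → ℝ) : Prop :=
  ∀ (i : Fin 2) (q : ℝ), revenue μ c M (Function.update p i q) i ≤ revenue μ c M p i

/-- A mechanism is standard if it is anonymous and always allocates prominence at symmetric
equilibria. -/
def IsStandard (μ : Measure ℝ) (c : ℝ) (M : ProminenceMechanism) : Prop :=
  (∀ (σ : Equiv.Perm (Fin 2)) (p : Fin 2 → ℝ) (i : Fin 2),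
      M.alloc p i = M.alloc (fun j => p (σ j)) (σ i)) ∧
    ∀ t : ℝ, IsEquilibrium μ c M (fun _ => t) → ∑ i, M.alloc (fun _ => t) i = 1

/-- `T(c)`: the prices implementable at a symmetric equilibrium of a standard mechanism. -/
def implementablePrices (μ : Measure ℝ) (c : ℝ) : Set ℝ :=
  {t | ∃ M : ProminenceMechanism, IsStandard μ c M ∧ IsEquilibrium μ c M fun _ => t}

/-- The values of consumer surplus achieved at symmetric equilibria of standard mechanisms. -/
def achievableSurplus (μ : Measure ℝ) (c : ℝ) : Set ℝ :=
  {s | ∃ (M : ProminenceMechanism) (t : ℝ), IsStandard μ c M ∧ IsEquilibrium μ c M (fun _ => t) ∧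
    s = average c (M.alloc fun _ => t) fun k => buyerUtility μ (fun _ => t) k}

/-- `D_c(x)` for `x ≥ 0` and two sellers: the demand of a seller who deviates upwards by `x` from a
symmetric equilibrium price, and thereby is not prominent. -/
def deviationDemand (μ : Measure ℝ) (V c x : ℝ) : ℝ :=
  if x < theta0 μ c - V then ∫ v in Icc V (theta0 μ c - x), (1 - cdf μ (v + x)) ∂μ else 0

/-- `t*(c) = sup_{x > 0} x D_c(x) / (1/2 - D_c(x))`. -/
def tStar (μ : Measure ℝ) (V c : ℝ) : ℝ :=
  sSup ((fun x => x * deviationDemand μ V c x / (1 / 2 - deviationDemand μ V c x)) '' Ioi 0)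

/-- The social welfare when both sellers post `t*(c)` and each is prominent with
probability `1/2`. -/
def welfareAtTStar (μ : Measure ℝ) (V c : ℝ) : ℝ :=
  average c (fun _ => 1 / 2) fun k => expectedWelfare μ (fun _ => tStar μ V c) k

/-- The consumer surplus when both sellers post `t*(c)` and each is prominent with
probability `1/2`. -/
def surplusAtTStar (μ : Measure ℝ) (V c : ℝ) : ℝ :=
  average c (fun _ => 1 / 2) fun k => buyerUtility μ (fun _ => tStar μ V c) k

end

end ProminenceMarket

/-! Write g(θ) = E[(v - θ)⁺], so that θ₀ inverts g. At equal prices t ≤ V the indices are θ₀(cost) -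
t and every buyer buys. The prominent seller comes first, and the second is inspected exactly when
the first value is below θ₀(c). Hence welfare W(c) = E[v] + E[(g(v) - c)⁺] does not depend on t, and
the consumer surplus is W(c) - t.

Lower bound on prices. A seller who raises the price by x above t ≤ V still sells with probability
at least D_c(x) = P(v₁ + x < θ₀(c), v₁ + x < v₂), whatever the mechanism does. Anonymity makes the
equilibrium demand 1/2, so (t + x) D_c(x) ≤ t/2 for all x > 0, which says t ≥ t*(c). A pigeonhole
estimate on |v₁ - v₂| gives t* ≤ 1 ≤ V. At prices above V the surplus is at most 1, while W - t* ≥ V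
- 1 ≥ 1. Conversely, giving prominence to the rival of any deviator supports t* when c is near c̄:
upward deviations fail by the definition of t*, and undercutting yields demand at most 1/2 at a
lower price.

Limits and maximum. t* is antitone and lower semicontinuous in c, and W is continuous. So W - t* is
upper semicontinuous and attains its maximum on [0, c̄], and it is right continuous at 0.

The strict gain near c̄ is a third-order comparison in δ = θ₀(c) - V. With a = f(V⁺) and b = f'(V⁺),
the search gain W - E[v] is at least aδ²/2 + (b/6 - a²/3)δ³ up to an arbitrarily small loss in the
cubic coefficient. Likewise t* is at most aδ²/2 + γδ³ for any γ above b/8 + a²/8 if a > 0 (the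
deviation x = δ/2 is critical), and above 4b/27 if a = 0 (critical x = δ/3). The quadratic terms
cancel; the cubic ones leave room when 11a² < b, which the hypothesis implies. The carrying lemmas
are `HasDensityBounds.le_integral_searchGain`, `exists_forall_scaled_le` and `exists_slopes`. -/

namespace ProminenceMarket

/-- The expected gain `E[(v - θ)⁺]` of a search with fallback value `θ`. -/
noncomputable def searchGain (μ : Measure ℝ) (θ : ℝ) : ℝ := ∫ v, max (v - θ) 0 ∂μ

/-! ### Search gain, reservation values and Weitzman indices. -/

section Indices

set_option linter.unusedSectionVars false

variable {μ : Measure ℝ} [IsProbabilityMeasure μ] {V : ℝ}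

lemma integrable_of_bounded_on (hs : ∀ᵐ v ∂μ, v ∈ Icc V (V + 1)) {φ : ℝ → ℝ} {C : ℝ}
    (hm : Measurable φ) (hC : ∀ v ∈ Icc V (V + 1), |φ v| ≤ C) : Integrable φ μ :=
  Integrable.of_bound hm.aestronglyMeasurable C (hs.mono fun v hv => hC v hv)

lemma integrable_of_continuous (hs : ∀ᵐ v ∂μ, v ∈ Icc V (V + 1)) {φ : ℝ → ℝ}
    (hφ : Continuous φ) : Integrable φ μ := by
  obtain ⟨C, hC⟩ := (isCompact_Icc (a := V) (b := V + 1)).exists_bound_of_continuousOn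
    hφ.continuousOn
  exact integrable_of_bounded_on hs hφ.measurable hC

lemma integrable_max_sub (hs : ∀ᵐ v ∂μ, v ∈ Icc V (V + 1)) (θ : ℝ) :
    Integrable (fun v => max (v - θ) 0) μ :=
  integrable_of_continuous hs (by fun_prop)

lemma searchGain_nonneg (θ : ℝ) : 0 ≤ searchGain μ θ :=
  integral_nonneg fun _ => le_max_right _ _

lemma searchGain_antitone (hs : ∀ᵐ v ∂μ, v ∈ Icc V (V + 1)) : Antitone (searchGain μ) :=
  fun θ θ' h => integral_mono (integrable_max_sub hs _) (integrable_max_sub hs _) fun v =>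
    max_le_max (by linarith) le_rfl

lemma searchGain_le_add (hs : ∀ᵐ v ∂μ, v ∈ Icc V (V + 1)) {θ θ' : ℝ} (h : θ ≤ θ') :
    searchGain μ θ ≤ searchGain μ θ' + (θ' - θ) := by
  have : searchGain μ θ' + (θ' - θ) = ∫ v, (max (v - θ') 0 + (θ' - θ)) ∂μ := by
    rw [integral_add (integrable_max_sub hs _) (integrable_const _)]
    simp [searchGain]
  rw [this]
  refine integral_mono (integrable_max_sub hs _)
    ((integrable_max_sub hs _).add (integrable_const _)) fun v => ?_
  rcases le_total (v - θ) 0 with h1 | h1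
  · simp only [max_eq_right h1]; linarith [le_max_right (v - θ') 0]
  · simp only [max_eq_left h1]; linarith [le_max_left (v - θ') 0]

lemma continuous_searchGain (hs : ∀ᵐ v ∂μ, v ∈ Icc V (V + 1)) : Continuous (searchGain μ) := by
  refine (LipschitzWith.of_dist_le_mul (K := 1) fun x y => ?_).continuous
  rw [Real.dist_eq, Real.dist_eq, NNReal.coe_one, one_mul]
  rcases le_total x y with h | h
  · have := searchGain_antitone hs h
    rw [abs_of_nonneg (by linarith), abs_of_nonpos (by linarith)]
    linarith [searchGain_le_add hs h]
  · have := searchGain_antitone hs h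
    rw [abs_of_nonpos (by linarith), abs_of_nonneg (by linarith)]
    linarith [searchGain_le_add hs h]

lemma searchGain_of_le (hs : ∀ᵐ v ∂μ, v ∈ Icc V (V + 1)) {θ : ℝ} (h : θ ≤ V) :
    searchGain μ θ = ∫ v, v ∂μ - θ := by
  have : searchGain μ θ = ∫ v, (v - θ) ∂μ :=
    integral_congr_ae (hs.mono fun v hv => max_eq_left (by linarith [hv.1]))
  rw [this, integral_sub (integrable_of_continuous hs continuous_id') (integrable_const _)]
  simp

lemma searchGain_eq_zero (hs : ∀ᵐ v ∂μ, v ∈ Icc V (V + 1)) {θ : ℝ} (h : V + 1 ≤ θ) :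
    searchGain μ θ = 0 := by
  have : searchGain μ θ = ∫ v, (0 : ℝ) ∂μ :=
    integral_congr_ae (hs.mono fun v hv => max_eq_right (by linarith [hv.2]))
  simpa using this

lemma le_integral_value (hs : ∀ᵐ v ∂μ, v ∈ Icc V (V + 1)) : V ≤ ∫ v, v ∂μ := by
  have h := integral_mono_ae (integrable_const V)
    (integrable_of_continuous hs continuous_id') (hs.mono fun v hv => hv.1)
  simpa using h

/-- The sublevel set of the continuous antitone gain is closed, nonempty and bounded below, hence a
closed half-line. This equivalence serves as the working definition of θ₀ and avoids treating `c =
0` apart. -/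
lemma theta0_le_iff (hs : ∀ᵐ v ∂μ, v ∈ Icc V (V + 1)) {c θ : ℝ} (hc : 0 ≤ c) :
    theta0 μ c ≤ θ ↔ searchGain μ θ ≤ c := by
  have hbdd : BddBelow {θ : ℝ | searchGain μ θ ≤ c} := by
    -- Below V the gain is E[v] - θ ≥ V - θ, so a gain of at most c forces θ ≥ V - c.
    refine ⟨min V (V - c), fun θ (hθ : searchGain μ θ ≤ c) => ?_⟩
    rcases le_total θ V with h | h
    · rw [searchGain_of_le hs h] at hθ
      exact (min_le_right _ _).trans (by linarith [le_integral_value hs])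
    · exact (min_le_left _ _).trans h
  have hne : {θ : ℝ | searchGain μ θ ≤ c}.Nonempty :=
    ⟨V + 1, (searchGain_eq_zero hs le_rfl).le.trans hc⟩
  have hmem := (isClosed_le (continuous_searchGain hs) continuous_const).csInf_mem hne hbdd
  exact ⟨fun h => (searchGain_antitone hs h).trans hmem, fun h => csInf_le hbdd h⟩

lemma lt_theta0_iff (hs : ∀ᵐ v ∂μ, v ∈ Icc V (V + 1)) {c θ : ℝ} (hc : 0 ≤ c) :
    θ < theta0 μ c ↔ c < searchGain μ θ := by
  rw [← not_le, theta0_le_iff hs hc, not_le]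

lemma searchGain_theta0 (hs : ∀ᵐ v ∂μ, v ∈ Icc V (V + 1)) {c : ℝ} (hc : 0 ≤ c) :
    searchGain μ (theta0 μ c) = c := by
  refine le_antisymm ((theta0_le_iff hs hc).1 le_rfl) ?_
  refine ge_of_tendsto (x := 𝓝[<] (theta0 μ c))
    ((continuous_searchGain hs).continuousAt.tendsto.mono_left nhdsWithin_le_nhds) ?_
  filter_upwards [self_mem_nhdsWithin] with θ hθ
  exact ((lt_theta0_iff hs hc).1 hθ).le

lemma theta0_antitoneOn (hs : ∀ᵐ v ∂μ, v ∈ Icc V (V + 1)) {c d : ℝ} (hc : 0 ≤ c) (h : c ≤ d) :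
    theta0 μ d ≤ theta0 μ c :=
  (theta0_le_iff hs (hc.trans h)).2 ((searchGain_theta0 hs hc).le.trans h)

lemma theta0_lt_theta0_zero (hs : ∀ᵐ v ∂μ, v ∈ Icc V (V + 1)) {c : ℝ} (hc : 0 < c) :
    theta0 μ c < theta0 μ 0 := by
  rw [lt_theta0_iff hs le_rfl, searchGain_theta0 hs hc.le]
  exact hc

lemma cBar_eq : cBar μ V = searchGain μ V := rfl

lemma le_theta0 (hs : ∀ᵐ v ∂μ, v ∈ Icc V (V + 1)) {c : ℝ} (hc : 0 ≤ c) (h : c ≤ cBar μ V) :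
    V ≤ theta0 μ c := by
  refine le_of_forall_lt fun θ hθ => (lt_theta0_iff hs hc).2 ?_
  rw [cBar_eq, searchGain_of_le hs le_rfl] at h
  rw [searchGain_of_le hs hθ.le]
  linarith

lemma lt_theta0 (hs : ∀ᵐ v ∂μ, v ∈ Icc V (V + 1)) {c : ℝ} (hc : 0 ≤ c) (h : c < cBar μ V) :
    V < theta0 μ c := (lt_theta0_iff hs hc).2 h

lemma searchGain_strict (hs : ∀ᵐ v ∂μ, v ∈ Icc V (V + 1)) [NullSingletonClass μ] {θ : ℝ} (h : V < θ) :
    searchGain μ θ < searchGain μ V := by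
  have hV : ∀ᵐ v ∂μ, v ≠ V := by simp [ae_iff]
  have hpos : ∀ᵐ v ∂μ, max (v - θ) 0 < max (v - V) 0 := by
    filter_upwards [hs, hV] with v hv hv'
    have : V < v := lt_of_le_of_ne hv.1 (Ne.symm hv')
    rw [max_eq_left (by linarith : (0 : ℝ) ≤ v - V)]
    exact max_lt (by linarith) (by linarith)
  refine lt_of_le_of_ne (searchGain_antitone hs h.le) fun heq => ?_
  have := (integral_eq_iff_of_ae_le (integrable_max_sub hs θ) (integrable_max_sub hs V)
    (hpos.mono fun v hv => hv.le)).1 heq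
  obtain ⟨v, h1, h2⟩ := (this.and hpos).exists
  exact h2.ne h1

lemma cBar_pos (hs : ∀ᵐ v ∂μ, v ∈ Icc V (V + 1)) [NullSingletonClass μ] : 0 < cBar μ V := by
  rw [cBar_eq, ← searchGain_eq_zero hs (le_refl (V + 1))]
  exact searchGain_strict hs (by linarith)

lemma theta0_cBar (hs : ∀ᵐ v ∂μ, v ∈ Icc V (V + 1)) : theta0 μ (cBar μ V) = V :=
  le_antisymm ((theta0_le_iff hs (searchGain_nonneg V)).2 le_rfl)
    (le_theta0 hs (searchGain_nonneg V) le_rfl)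

lemma tendsto_theta0_cBar (hs : ∀ᵐ v ∂μ, v ∈ Icc V (V + 1)) [NullSingletonClass μ] :
    Tendsto (theta0 μ) (𝓝[<] (cBar μ V)) (𝓝[>] V) := by
  have hpos : ∀ᶠ c in 𝓝[<] (cBar μ V), 0 < c :=
    nhdsWithin_le_nhds (lt_mem_nhds (cBar_pos hs))
  have hV : ∀ᶠ c in 𝓝[<] (cBar μ V), V < theta0 μ c := by
    filter_upwards [hpos, self_mem_nhdsWithin] with c hc hc'
    exact lt_theta0 hs hc.le hc'
  refine tendsto_nhdsWithin_iff.2 ⟨tendsto_order.2 ⟨fun θ hθ => ?_, fun θ hθ => ?_⟩, hV⟩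
  · filter_upwards [hV] with c hc using hθ.trans hc
  · obtain ⟨θ', h1, h2⟩ := exists_between hθ
    filter_upwards [hpos, nhdsWithin_le_nhds (lt_mem_nhds (searchGain_strict hs h1))] with c hc hc'
    exact ((theta0_le_iff hs hc.le).2 hc'.le).trans_lt h2

lemma integrable_index (hs : ∀ᵐ v ∂μ, v ∈ Icc V (V + 1)) (p θ : ℝ) :
    Integrable (fun v => max (max (v - p) 0 - θ) 0) μ :=
  integrable_of_continuous hs (by fun_prop)

lemma searchGain_le_index (hs : ∀ᵐ v ∂μ, v ∈ Icc V (V + 1)) (p θ : ℝ) :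
    searchGain μ (p + θ) ≤ ∫ v, max (max (v - p) 0 - θ) 0 ∂μ :=
  integral_mono (integrable_max_sub hs _) (integrable_index hs _ _) fun v =>
    max_le_max (by linarith [le_max_left (v - p) 0]) le_rfl

lemma index_of_nonneg (p : ℝ) {θ : ℝ} (h : 0 ≤ θ) :
    ∫ v, max (max (v - p) 0 - θ) 0 ∂μ = searchGain μ (p + θ) := by
  refine integral_congr_ae (ae_of_all _ fun v => ?_)
  simp only
  rcases le_total (v - p) 0 with h1 | h1
  · rw [max_eq_right h1, max_eq_right (by linarith), max_eq_right (by linarith)]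
  · rw [max_eq_left h1, sub_sub]

lemma theta0_sub_le_of_index_le (hs : ∀ᵐ v ∂μ, v ∈ Icc V (V + 1)) {p k c θ : ℝ} (hc : 0 ≤ c)
    (hk : k ≤ c) (h : ∫ v, max (max (v - p) 0 - θ) 0 ∂μ ≤ k) : theta0 μ c - p ≤ θ := by
  have := (theta0_le_iff hs hc).2 ((searchGain_le_index hs p θ).trans (h.trans hk))
  linarith

/-- Dropping the inner positive part only lowers the integral that defines the index. No restriction
on `p` is needed, so the bound serves for arbitrary deviations. -/
lemma theta0_sub_le_weitzmanIndex (hs : ∀ᵐ v ∂μ, v ∈ Icc V (V + 1)) {p k c : ℝ} (hk : 0 ≤ k)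
    (hkc : k ≤ c) : theta0 μ c - p ≤ weitzmanIndex μ p k := by
  refine le_csInf ⟨max (V + 1 - p) 0, ?_⟩ fun θ hθ =>
    theta0_sub_le_of_index_le hs (hk.trans hkc) hkc hθ
  rw [mem_ofPred_eq, index_of_nonneg p (le_max_right _ _), searchGain_eq_zero hs]
  · exact hk
  · linarith [le_max_left (V + 1 - p) 0]

lemma weitzmanIndex_le (hs : ∀ᵐ v ∂μ, v ∈ Icc V (V + 1)) {p k θ : ℝ} (hk : 0 ≤ k)
    (h : ∫ v, max (max (v - p) 0 - θ) 0 ∂μ ≤ k) : weitzmanIndex μ p k ≤ θ :=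
  csInf_le ⟨theta0 μ k - p, fun _ hθ => theta0_sub_le_of_index_le hs hk le_rfl hθ⟩ h

/-- The candidate θ₀(k) - p is nonnegative, so the inner positive part has no effect there. -/
lemma weitzmanIndex_of_le (hs : ∀ᵐ v ∂μ, v ∈ Icc V (V + 1)) {p k : ℝ} (hk : 0 ≤ k)
    (hp : p ≤ theta0 μ k) : weitzmanIndex μ p k = theta0 μ k - p := by
  refine le_antisymm (weitzmanIndex_le hs hk ?_) (theta0_sub_le_weitzmanIndex hs hk le_rfl)
  rw [index_of_nonneg p (by linarith), add_sub_cancel, searchGain_theta0 hs hk]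

end Indices

/-! ### The index policy for two sellers, and averages over orders of search and prominence. -/

section Policy

variable {θ p v : Fin 2 → ℝ} {a : Fin 2}

lemma sum_eq_add_rev (φ : Fin 2 → ℝ) (a : Fin 2) : ∑ i, φ i = φ a + φ a.rev := by
  fin_cases a <;> simp [Fin.sum_univ_two, Fin.rev, add_comm]

lemma rev_ne (a : Fin 2) : a.rev ≠ a := by fin_cases a <;> decide

lemma eq_rev_of_ne {a b : Fin 2} (h : a ≠ b) : a = b.rev := by
  revert h; fin_cases a <;> fin_cases b <;> simp [Fin.rev]

lemma inspects_first : Inspects θ p v a a ↔ 0 ≤ θ a := by simp [Inspects]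

lemma inspects_rev : Inspects θ p v a a.rev ↔ 0 ≤ θ a.rev ∧ v a - p a < θ a.rev := by
  simp [Inspects, rev_ne]

lemma buys_first : Buys θ p v a a ↔ 0 ≤ θ a ∧ 0 ≤ v a - p a ∧
    (0 ≤ θ a.rev → v a - p a < θ a.rev → v a.rev - p a.rev ≤ v a - p a) := by
  have : (∀ j, j ≠ a → Inspects θ p v a j →
      v j - p j < v a - p a ∨ (v j - p j = v a - p a ∧ a = a)) ↔
      (0 ≤ θ a.rev → v a - p a < θ a.rev → v a.rev - p a.rev ≤ v a - p a) := by
    constructor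
    · intro h h1 h2
      rcases h a.rev (rev_ne a) (inspects_rev.2 ⟨h1, h2⟩) with h | h
      exacts [h.le, h.1.le]
    · intro h j hj hi
      obtain rfl := eq_rev_of_ne hj
      have := h (inspects_rev.1 hi).1 (inspects_rev.1 hi).2
      simpa [le_iff_lt_or_eq] using this
  rw [Buys, inspects_first, this]

lemma buys_rev : Buys θ p v a a.rev ↔ (0 ≤ θ a.rev ∧ v a - p a < θ a.rev) ∧
    0 ≤ v a.rev - p a.rev ∧ (0 ≤ θ a → v a - p a < v a.rev - p a.rev) := by
  have : (∀ j, j ≠ a.rev → Inspects θ p v a j →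
      v j - p j < v a.rev - p a.rev ∨ (v j - p j = v a.rev - p a.rev ∧ a.rev = a)) ↔
      (0 ≤ θ a → v a - p a < v a.rev - p a.rev) := by
    constructor
    · intro h h1
      rcases h a (rev_ne a).symm (inspects_first.2 h1) with h | h
      exacts [h, (rev_ne a h.2).elim]
    · intro h j hj hi
      obtain rfl : j = a := by simpa using eq_rev_of_ne hj
      exact Or.inl (h (inspects_first.1 hi))
  rw [Buys, inspects_rev, this]

lemma firstProb_nonneg (θ : Fin 2 → ℝ) (a : Fin 2) : 0 ≤ firstProb θ a := by
  unfold firstProb; split_ifs <;> norm_num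

lemma firstProb_add_rev (θ : Fin 2 → ℝ) (a : Fin 2) :
    firstProb θ a + firstProb θ a.rev = 1 := by
  unfold firstProb
  rw [Fin.rev_rev]
  rcases lt_trichotomy (θ a) (θ a.rev) with h | h | h
  · simp [h, h.not_gt, h.ne']
  · simp [h]; norm_num
  · simp [h, h.not_gt, h.ne']

lemma sum_firstProb (θ : Fin 2 → ℝ) : ∑ a, firstProb θ a = 1 := by
  rw [sum_eq_add_rev _ 0, firstProb_add_rev]

lemma firstProb_eq_zero (h : θ a < θ a.rev) : firstProb θ a = 0 := by
  simp [firstProb, h.not_gt, h.ne']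

lemma firstProb_eq_one (h : θ a.rev < θ a) : firstProb θ a = 1 := by
  simp [firstProb, h]

lemma sum_firstProb_mul_eq {X : Fin 2 → ℝ} {r : ℝ} (h : ∀ a, firstProb θ a ≠ 0 → X a = r) :
    ∑ a, firstProb θ a * X a = r := by
  have : ∀ a ∈ Finset.univ, firstProb θ a * X a = firstProb θ a * r := fun a _ => by
    by_cases h0 : firstProb θ a = 0
    · simp [h0]
    · rw [h a h0]
  rw [Finset.sum_congr rfl this, ← Finset.sum_mul, sum_firstProb, one_mul]

lemma sum_firstProb_mul_le {X : Fin 2 → ℝ} {r : ℝ} (h : ∀ a, X a ≤ r) :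
    ∑ a, firstProb θ a * X a ≤ r :=
  calc ∑ a, firstProb θ a * X a ≤ ∑ a, firstProb θ a * r :=
        Finset.sum_le_sum fun a _ => mul_le_mul_of_nonneg_left (h a) (firstProb_nonneg θ a)
    _ = r := by rw [← Finset.sum_mul, sum_firstProb, one_mul]

lemma le_sum_firstProb_mul {X : Fin 2 → ℝ} {r : ℝ} (h : ∀ a, r ≤ X a) :
    r ≤ ∑ a, firstProb θ a * X a :=
  calc r = ∑ a, firstProb θ a * r := by rw [← Finset.sum_mul, sum_firstProb, one_mul]
    _ ≤ _ := Finset.sum_le_sum fun a _ => mul_le_mul_of_nonneg_left (h a) (firstProb_nonneg θ a)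

lemma average_eq {c : ℝ} {x : Fin 2 → ℝ} (hx : ∑ w, x w = 1) (g : (Fin 2 → ℝ) → ℝ) :
    average c x g = ∑ w, x w * g (prominentCosts c w) := by
  simp [average, hx]

lemma average_const {c : ℝ} {x : Fin 2 → ℝ} (hx : ∑ w, x w = 1) {g : (Fin 2 → ℝ) → ℝ} {r : ℝ}
    (h : ∀ w, g (prominentCosts c w) = r) : average c x g = r := by
  rw [average_eq hx, Finset.sum_congr rfl fun w _ => by rw [h w], ← Finset.sum_mul, hx, one_mul]

lemma le_average {c : ℝ} {x : Fin 2 → ℝ} (hx : ∀ i, 0 ≤ x i) (hx1 : ∑ i, x i ≤ 1)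
    {g : (Fin 2 → ℝ) → ℝ} {r : ℝ} (h : ∀ w, r ≤ g (prominentCosts c w))
    (h' : r ≤ g fun _ => c) : r ≤ average c x g := by
  have h1 : ∑ w, x w * r ≤ ∑ w, x w * g (prominentCosts c w) :=
    Finset.sum_le_sum fun a _ => mul_le_mul_of_nonneg_left (h a) (hx a)
  have h2 := mul_le_mul_of_nonneg_left h' (sub_nonneg.2 hx1)
  rw [← Finset.sum_mul] at h1
  unfold average
  linarith

lemma prominentCosts_self (c : ℝ) (w : Fin 2) : prominentCosts c w w = 0 := by
  simp [prominentCosts]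

lemma prominentCosts_rev (c : ℝ) (w : Fin 2) : prominentCosts c w w.rev = c := by
  simp [prominentCosts, rev_ne]

lemma prominentCosts_nonneg {c : ℝ} (hc : 0 ≤ c) (w i : Fin 2) : 0 ≤ prominentCosts c w i := by
  unfold prominentCosts; split_ifs <;> simp [hc]

lemma prominentCosts_le {c : ℝ} (hc : 0 ≤ c) (w i : Fin 2) : prominentCosts c w i ≤ c := by
  unfold prominentCosts; split_ifs <;> simp [hc]

end Policy

/-! ### Demand, surplus and welfare at equal prices and after one deviation. -/

section Market

set_option linter.unusedSectionVars false

variable {μ : Measure ℝ} [IsProbabilityMeasure μ] {V : ℝ}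

instance : IsProbabilityMeasure (valueLaw μ) := by unfold valueLaw; infer_instance

lemma measurePreserving_pair (o : Fin 2) :
    MeasurePreserving (fun v : Fin 2 → ℝ => (v o, v o.rev)) (valueLaw μ) (μ.prod μ) := by
  have h := measurePreserving_piFinTwo (fun _ : Fin 2 => μ)
  fin_cases o
  · exact h
  · exact Measure.measurePreserving_swap.comp h

lemma integral_pair (o : Fin 2) {H : ℝ × ℝ → ℝ} (hH : Measurable H) :
    ∫ v, H (v o, v o.rev) ∂(valueLaw μ) = ∫ z, H z ∂(μ.prod μ) := by
  rw [← (measurePreserving_pair (μ := μ) o).map_eq, integral_map]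
  · exact (measurePreserving_pair (μ := μ) o).measurable.aemeasurable
  · exact hH.aestronglyMeasurable

lemma measureReal_pair (o : Fin 2) {s : Set (ℝ × ℝ)} (hs : MeasurableSet s) :
    (valueLaw μ).real {v | (v o, v o.rev) ∈ s} = (μ.prod μ).real s :=
  (measurePreserving_pair o).measureReal_preimage hs.nullMeasurableSet

lemma ae_valueLaw {P : ℝ → Prop} (h : ∀ᵐ v ∂μ, P v) : ∀ᵐ v ∂(valueLaw μ), ∀ i, P (v i) :=
  ae_all_iff.2 fun i => (Measure.quasiMeasurePreserving_eval (fun _ : Fin 2 => μ) i).ae h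

/-- The expected welfare when a buyer inspects a first seller for free and a second one at
cost `c`, at equal prices. -/
noncomputable def searchWelfare (μ : Measure ℝ) (c : ℝ) : ℝ :=
  ∫ v, v ∂μ + ∫ v, max (searchGain μ v - c) 0 ∂μ

/-- The welfare when the first value found is `z.1`, the second is `z.2`, and the search goes on
while the value is below `θ`. -/
noncomputable def valueFound (θ c : ℝ) (z : ℝ × ℝ) : ℝ :=
  if z.1 < θ then max z.1 z.2 - c else z.1

lemma measurable_valueFound (θ c : ℝ) : Measurable (valueFound θ c) :=
  Measurable.ite (measurableSet_lt measurable_fst measurable_const) (by fun_prop) (by fun_prop)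

lemma ae_prod_mem (hs : ∀ᵐ v ∂μ, v ∈ Icc V (V + 1)) :
    ∀ᵐ z ∂(μ.prod μ), z.1 ∈ Icc V (V + 1) ∧ z.2 ∈ Icc V (V + 1) :=
  (Measure.quasiMeasurePreserving_fst.ae hs).and (Measure.quasiMeasurePreserving_snd.ae hs)

lemma integrable_valueFound (hs : ∀ᵐ v ∂μ, v ∈ Icc V (V + 1)) (θ c : ℝ) :
    Integrable (valueFound θ c) (μ.prod μ) := by
  refine Integrable.of_bound (measurable_valueFound θ c).aestronglyMeasurable
    (|V| + 1 + |c|) ((ae_prod_mem hs).mono fun z hz => ?_)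
  have h1 : |z.1| ≤ |V| + 1 := by
    rw [abs_le]
    constructor <;> linarith [hz.1.1, hz.1.2, neg_abs_le V, le_abs_self V]
  have h2 : |max z.1 z.2| ≤ |V| + 1 := by
    rw [abs_le]
    constructor
    · exact le_max_of_le_left (abs_le.1 h1).1
    · refine max_le (abs_le.1 h1).2 ?_
      linarith [hz.2.2, le_abs_self V]
  rw [Real.norm_eq_abs, valueFound]
  split_ifs
  · exact (abs_sub _ _).trans (by linarith)
  · linarith [abs_nonneg c]

/-- Given a first value s, one more search adds g(s) - c, and the rule s < θ₀(c) continues exactly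
when this is positive. -/
lemma integral_valueFound (hs : ∀ᵐ v ∂μ, v ∈ Icc V (V + 1)) {c : ℝ} (hc : 0 ≤ c) :
    ∫ z, valueFound (theta0 μ c) c z ∂(μ.prod μ) = searchWelfare μ c := by
  have hg := continuous_searchGain hs
  rw [integral_prod _ (integrable_valueFound hs _ _), searchWelfare, ← integral_add
    (integrable_of_continuous hs continuous_id')
    (integrable_of_continuous hs (φ := fun v => max (searchGain μ v - c) 0) (by fun_prop))]
  refine integral_congr_ae (ae_of_all _ fun s => ?_)
  simp only [valueFound]
  by_cases h : s < theta0 μ c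
  · have h' := (lt_theta0_iff hs hc).1 h
    simp only [h, if_true]
    rw [max_eq_left (by linarith : (0 : ℝ) ≤ searchGain μ s - c), searchGain]
    have : ∀ v, max s v - c = max (v - s) 0 + (s - c) := fun v => by
      rcases le_total s v with h | h
      · rw [max_eq_right h, max_eq_left (by linarith)]; ring
      · rw [max_eq_left h, max_eq_right (by linarith)]; ring
    simp_rw [this]
    rw [integral_add (integrable_max_sub hs _) (integrable_const _)]
    simp; ring
  · have h' := (theta0_le_iff hs hc).1 (not_lt.1 h)
    simp only [h, if_false]
    rw [max_eq_right (by linarith : searchGain μ s - c ≤ 0)]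
    simp

lemma indices_const (hs : ∀ᵐ v ∂μ, v ∈ Icc V (V + 1)) {c t : ℝ} (hcc : c ≤ cBar μ V)
    (ht : t ≤ V) {k : Fin 2 → ℝ} {i : Fin 2} (hk : 0 ≤ k i) (hkc : k i ≤ c) :
    indices μ (fun _ => t) k i = theta0 μ (k i) - t :=
  weitzmanIndex_of_le hs hk (ht.trans (le_theta0 hs hk (hkc.trans hcc)))

/-- For `c > 0` the prominent seller has the strictly higher index. For `c = 0` either seller may
come first, but both costs vanish. -/
lemma costs_of_firstProb_ne_zero (hs : ∀ᵐ v ∂μ, v ∈ Icc V (V + 1)) {c t : ℝ} (hc : 0 ≤ c)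
    (hcc : c ≤ cBar μ V) (ht : t ≤ V) {w a : Fin 2}
    (h : firstProb (indices μ (fun _ => t) (prominentCosts c w)) a ≠ 0) :
    prominentCosts c w a = 0 ∧ prominentCosts c w a.rev = c := by
  rcases hc.eq_or_lt with rfl | hc'
  · simp [prominentCosts]
  by_cases haw : a = w
  · subst haw; exact ⟨prominentCosts_self _ _, prominentCosts_rev _ _⟩
  · refine (h (firstProb_eq_zero ?_)).elim
    obtain rfl := eq_rev_of_ne haw
    rw [indices_const hs hcc ht (prominentCosts_nonneg hc _ _) (prominentCosts_le hc _ _),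
      indices_const hs hcc ht (prominentCosts_nonneg hc _ _) (prominentCosts_le hc _ _),
      Fin.rev_rev, prominentCosts_self, prominentCosts_rev]
    linarith [theta0_lt_theta0_zero hs hc']

/-- The realized surplus (`m = t`) or welfare (`m = 0`) at equal prices `t ≤ V`. -/
lemma realized_eq (hs : ∀ᵐ v ∂μ, v ∈ Icc V (V + 1)) {c t : ℝ} (hc : 0 ≤ c) (hcc : c ≤ cBar μ V)
    (ht : t ≤ V) {w a : Fin 2}
    (h : firstProb (indices μ (fun _ => t) (prominentCosts c w)) a ≠ 0) (m : ℝ)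
    {v : Fin 2 → ℝ} (hv : ∀ i, v i ∈ Icc V (V + 1)) :
    ∑ i, ({v | Buys (indices μ (fun _ => t) (prominentCosts c w)) (fun _ => t) v a i}.indicator
        (fun v => v i - m) v
      - {v | Inspects (indices μ (fun _ => t) (prominentCosts c w)) (fun _ => t) v a i}.indicator
        (fun _ => prominentCosts c w i) v) = valueFound (theta0 μ c) c (v a, v a.rev) - m := by
  obtain ⟨h1, h2⟩ := costs_of_firstProb_ne_zero hs hc hcc ht h
  have e1 := indices_const hs hcc ht (prominentCosts_nonneg hc w a) (prominentCosts_le hc w a)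
  have e2 := indices_const hs hcc ht (prominentCosts_nonneg hc w a.rev)
    (prominentCosts_le hc w a.rev)
  rw [h1] at e1
  rw [h2] at e2
  have n1 : 0 ≤ theta0 μ 0 - t := by
    linarith [le_theta0 hs le_rfl (hc.trans hcc)]
  have n2 : 0 ≤ theta0 μ c - t := by linarith [le_theta0 hs hc hcc]
  have n3 : t ≤ v a := ht.trans (hv a).1
  have n4 : t ≤ v a.rev := ht.trans (hv a.rev).1
  rw [sum_eq_add_rev _ a]
  simp only [indicator, mem_ofPred_eq, inspects_first, inspects_rev, buys_first, buys_rev, e1, e2,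
    h1, h2, n1, n2, valueFound, sub_lt_sub_iff_right, sub_nonneg, n3, n4, true_and, forall_const,
    sub_le_sub_iff_right]
  by_cases h3 : v a < theta0 μ c
  · by_cases h4 : v a < v a.rev
    · simp [h3, h4, h4.not_ge, h4.le]; ring
    · simp [h3, h4, not_lt.1 h4]; ring
  · simp [h3]

lemma buyerUtility_const (hs : ∀ᵐ v ∂μ, v ∈ Icc V (V + 1)) {c t : ℝ} (hc : 0 ≤ c)
    (hcc : c ≤ cBar μ V) (ht : t ≤ V) (w : Fin 2) :
    buyerUtility μ (fun _ => t) (prominentCosts c w) = searchWelfare μ c - t := by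
  refine sum_firstProb_mul_eq fun a ha => ?_
  rw [integral_congr_ae ((ae_valueLaw hs).mono fun v hv => realized_eq hs hc hcc ht ha t hv),
    integral_pair a (H := fun z => valueFound (theta0 μ c) c z - t)
      ((measurable_valueFound _ _).sub_const t),
    integral_sub (integrable_valueFound hs _ _) (integrable_const _), integral_valueFound hs hc]
  simp

lemma expectedWelfare_const (hs : ∀ᵐ v ∂μ, v ∈ Icc V (V + 1)) {c t : ℝ} (hc : 0 ≤ c)
    (hcc : c ≤ cBar μ V) (ht : t ≤ V) (w : Fin 2) :
    expectedWelfare μ (fun _ => t) (prominentCosts c w) = searchWelfare μ c := by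
  refine sum_firstProb_mul_eq fun a ha => ?_
  rw [integral_congr_ae (g := fun v => valueFound (theta0 μ c) c (v a, v a.rev))
    ((ae_valueLaw hs).mono fun v hv => ?_),
    integral_pair a (measurable_valueFound _ _), integral_valueFound hs hc]
  simpa using realized_eq hs hc hcc ht ha 0 hv

lemma buyerUtility_le_one (hs : ∀ᵐ v ∂μ, v ∈ Icc V (V + 1)) {t : ℝ} (ht : V ≤ t)
    {k : Fin 2 → ℝ} (hk : ∀ i, 0 ≤ k i) : buyerUtility μ (fun _ => t) k ≤ 1 := by
  refine sum_firstProb_mul_le fun a => ?_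
  set φ := fun v => ∑ i, ({v | Buys (indices μ (fun _ => t) k) (fun _ => t) v a i}.indicator
      (fun v => v i - t) v
    - {v | Inspects (indices μ (fun _ => t) k) (fun _ => t) v a i}.indicator
      (fun _ => k i) v) with hφ
  by_cases hi : Integrable φ (valueLaw μ)
  · refine (integral_mono_ae (g := fun _ => (1 : ℝ)) hi (integrable_const _) ?_).trans (by simp)
    filter_upwards [ae_valueLaw hs] with v hv
    have i1 : 0 ≤ {v | Inspects (indices μ (fun _ => t) k) (fun _ => t) v a a}.indicator
      (fun _ => k a) v := indicator_nonneg (fun _ _ => hk a) v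
    have i2 : 0 ≤ {v | Inspects (indices μ (fun _ => t) k) (fun _ => t) v a a.rev}.indicator
      (fun _ => k a.rev) v := indicator_nonneg (fun _ _ => hk a.rev) v
    have l1 : v a - t ≤ 1 := by linarith [(hv a).2]
    have l2 : v a.rev - t ≤ 1 := by linarith [(hv a.rev).2]
    have : {v | Buys (indices μ (fun _ => t) k) (fun _ => t) v a a}.indicator
        (fun v => v a - t) v + {v | Buys (indices μ (fun _ => t) k) (fun _ => t) v a a.rev}.indicator
        (fun v => v a.rev - t) v ≤ 1 := by
      simp only [indicator, mem_ofPred_eq]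
      by_cases b1 : Buys (indices μ (fun _ => t) k) (fun _ => t) v a a
      · have b2 : ¬ Buys (indices μ (fun _ => t) k) (fun _ => t) v a a.rev := fun b2 => by
          have c1 := buys_first.1 b1
          have c2 := buys_rev.1 b2
          exact absurd (c1.2.2 c2.1.1 c2.1.2) (not_le.2 (c2.2.2 c1.1))
        simp [b1, b2]; linarith
      · by_cases b2 : Buys (indices μ (fun _ => t) k) (fun _ => t) v a a.rev
        · simp [b1, b2]; linarith
        · simp [b1, b2]
    simp only [hφ]
    rw [sum_eq_add_rev _ a]
    linarith
  -- A non-integrable function has integral 0 by convention, so the bound needs no measurability of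
  -- the purchase events.
  · rw [integral_undef hi]; exact zero_le_one

lemma measurableSet_demand (x θ : ℝ) :
    MeasurableSet {z : ℝ × ℝ | z.1 + x < θ ∧ z.1 + x < z.2} :=
  (measurableSet_lt (f := fun z : ℝ × ℝ => z.1 + x) (by fun_prop) measurable_const).inter
    (measurableSet_lt (f := fun z : ℝ × ℝ => z.1 + x) (by fun_prop) measurable_snd)

/-- The probability of a purchase from the second of two sellers in the order of search, who asks
for `x` more than the first one. -/
noncomputable def secondDemand (μ : Measure ℝ) (θ x : ℝ) : ℝ :=
  (μ.prod μ).real {z | z.1 + x < θ ∧ z.1 + x < z.2}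

lemma purchaseProb_const (hs : ∀ᵐ v ∂μ, v ∈ Icc V (V + 1)) {c t : ℝ} (hc : 0 < c)
    (hcc : c ≤ cBar μ V) (ht : t ≤ V) (w : Fin 2) :
    purchaseProb μ (fun _ => t) (prominentCosts c w) w = 1 - secondDemand μ (theta0 μ c) 0 ∧
    purchaseProb μ (fun _ => t) (prominentCosts c w) w.rev = secondDemand μ (theta0 μ c) 0 := by
  have e1 := indices_const hs hcc ht (prominentCosts_nonneg hc.le w w)
    (prominentCosts_le hc.le w w)
  have e2 := indices_const hs hcc ht (prominentCosts_nonneg hc.le w w.rev)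
    (prominentCosts_le hc.le w w.rev)
  rw [prominentCosts_self] at e1
  rw [prominentCosts_rev] at e2
  have hlt := theta0_lt_theta0_zero hs hc
  have n1 : 0 ≤ theta0 μ 0 - t := by linarith [le_theta0 hs hc.le hcc]
  have n2 : 0 ≤ theta0 μ c - t := by linarith [le_theta0 hs hc.le hcc]
  have f1 : firstProb (indices μ (fun _ => t) (prominentCosts c w)) w = 1 :=
    firstProb_eq_one (by rw [e1, e2]; linarith)
  have f2 : firstProb (indices μ (fun _ => t) (prominentCosts c w)) w.rev = 0 :=
    firstProb_eq_zero (by rw [Fin.rev_rev, e1, e2]; linarith)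
  have hms := measurableSet_demand 0 (theta0 μ c)
  have key : ∀ i, purchaseProb μ (fun _ => t) (prominentCosts c w) i = (valueLaw μ).real
      {v | Buys (indices μ (fun _ => t) (prominentCosts c w)) (fun _ => t) v w i} := fun i => by
    rw [purchaseProb, sum_eq_add_rev _ w, f1, f2]; simp
  have m2 : ∀ᵐ v ∂(valueLaw μ),
      (Buys (indices μ (fun _ => t) (prominentCosts c w)) (fun _ => t) v w w.rev ↔
        (v w, v w.rev) ∈ {z : ℝ × ℝ | z.1 + 0 < theta0 μ c ∧ z.1 + 0 < z.2}) ∧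
      (Buys (indices μ (fun _ => t) (prominentCosts c w)) (fun _ => t) v w w ↔
        (v w, v w.rev) ∈ {z : ℝ × ℝ | z.1 + 0 < theta0 μ c ∧ z.1 + 0 < z.2}ᶜ) := by
    filter_upwards [ae_valueLaw hs] with v hv
    have n3 : t ≤ v w := ht.trans (hv w).1
    have n4 : t ≤ v w.rev := ht.trans (hv w.rev).1
    simp only [buys_first, buys_rev, e1, e2, n1, n2, sub_lt_sub_iff_right, sub_nonneg, n3, n4,
      true_and, forall_const, sub_le_sub_iff_right, mem_compl_iff, mem_ofPred_eq, not_and, not_lt,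
      add_zero, and_self]
  constructor
  · rw [key, secondDemand, ← probReal_compl_eq_one_sub hms, ← measureReal_pair w hms.compl]
    exact measureReal_congr (m2.mono fun v hv => propext hv.2)
  · rw [key, secondDemand, ← measureReal_pair w hms]
    exact measureReal_congr (m2.mono fun v hv => propext hv.1)

lemma average_half_purchaseProb (hs : ∀ᵐ v ∂μ, v ∈ Icc V (V + 1)) {c t : ℝ} (hc : 0 < c)
    (hcc : c ≤ cBar μ V) (ht : t ≤ V) (i : Fin 2) :
    average c (fun _ => 1 / 2) (fun k => purchaseProb μ (fun _ => t) k i) = 1 / 2 := by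
  rw [average_eq (by norm_num), sum_eq_add_rev _ i, (purchaseProb_const hs hc hcc ht i).1]
  have := (purchaseProb_const hs hc hcc ht i.rev).2
  rw [Fin.rev_rev] at this
  rw [this]
  ring

/-- On the event `v i.rev + x < θ₀(c)` and `v i.rev + x < v i`, the utility found at the rival lies
below the index of `i`, and `i` offers more. So `i` sells whether inspected first or second, for all
costs in [0, c]. -/
lemma secondDemand_le_purchaseProb (hs : ∀ᵐ v ∂μ, v ∈ Icc V (V + 1)) {c t x : ℝ}
    (ht : t ≤ V) {p k : Fin 2 → ℝ} {i : Fin 2} (hp : p i = t + x) (hp' : p i.rev = t)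
    (hk : ∀ j, 0 ≤ k j) (hkc : ∀ j, k j ≤ c) :
    secondDemand μ (theta0 μ c) x ≤ purchaseProb μ p k i := by
  have hi : theta0 μ c - (t + x) ≤ indices μ p k i := by
    rw [← hp]; exact theta0_sub_le_weitzmanIndex hs (hk i) (hkc i)
  refine le_sum_firstProb_mul fun a => ?_
  rw [secondDemand, ← measureReal_pair i.rev (measurableSet_demand _ _)]
  refine ENNReal.toReal_mono (measure_ne_top _ _) (measure_mono_ae ?_)
  filter_upwards [ae_valueLaw hs] with v hv hvm
  obtain ⟨h1, h2⟩ : v i.rev + x < theta0 μ c ∧ v i.rev + x < v i := by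
    have h : v i.rev + x < theta0 μ c ∧ v i.rev + x < v i.rev.rev := hvm
    rwa [Fin.rev_rev] at h
  have h3 := (hv i.rev).1
  change Buys (indices μ p k) p v a i
  by_cases hai : a = i
  · subst hai
    refine buys_first.2 ⟨by linarith, by rw [hp]; linarith, fun _ _ => by rw [hp, hp']; linarith⟩
  · obtain rfl := eq_rev_of_ne hai
    have := buys_rev (θ := indices μ p k) (p := p) (v := v) (a := i.rev)
    rw [Fin.rev_rev] at this
    rw [this, hp, hp']
    exact ⟨⟨by linarith, by linarith⟩, by linarith, fun _ => by linarith⟩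

lemma purchaseProb_le_secondDemand (hs : ∀ᵐ v ∂μ, v ∈ Icc V (V + 1)) {c t q : ℝ} (hc : 0 < c)
    (hcc : c ≤ cBar μ V) (ht : t ≤ V) {p : Fin 2 → ℝ} {i : Fin 2} (hp : p i = q)
    (hp' : p i.rev = t) (hq : theta0 μ c - q < theta0 μ 0 - t) :
    purchaseProb μ p (prominentCosts c i.rev) i ≤ secondDemand μ (theta0 μ c) (q - t) := by
  have e1 : indices μ p (prominentCosts c i.rev) i.rev = theta0 μ 0 - t := by
    rw [indices, prominentCosts_self, hp',
      weitzmanIndex_of_le hs le_rfl (ht.trans (le_theta0 hs le_rfl (hc.le.trans hcc)))]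
  have hki : prominentCosts c i.rev i = c := by
    simpa using prominentCosts_rev c i.rev
  have n1 : 0 ≤ theta0 μ 0 - t := by linarith [le_theta0 hs le_rfl (hc.le.trans hcc)]
  have hθ := le_theta0 hs hc.le hcc
  have hθ' := theta0_lt_theta0_zero hs hc
  -- A price above θ₀(c) makes the index at most 0. Such a seller sells with probability zero,
  -- because the rival, searched first, already offers utility at least V - t ≥ 0.
  have e2 : indices μ p (prominentCosts c i.rev) i ≤ 0 ∨
      indices μ p (prominentCosts c i.rev) i = theta0 μ c - q := by
    rw [indices, hki, hp]
    rcases le_or_gt q (theta0 μ c) with h | h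
    · exact Or.inr (weitzmanIndex_of_le hs hc.le h)
    · exact Or.inl (weitzmanIndex_le hs hc.le (by
        rw [index_of_nonneg q le_rfl, add_zero]; exact (theta0_le_iff hs hc.le).1 h.le))
  have f1 : firstProb (indices μ p (prominentCosts c i.rev)) i.rev = 1 :=
    firstProb_eq_one (by rw [e1, Fin.rev_rev]; rcases e2 with h | h <;> linarith)
  have f2 : firstProb (indices μ p (prominentCosts c i.rev)) i = 0 :=
    firstProb_eq_zero (by rw [e1]; rcases e2 with h | h <;> linarith)
  rw [purchaseProb, sum_eq_add_rev _ i, f1, f2, zero_mul, zero_add, one_mul, secondDemand,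
    ← measureReal_pair i.rev (measurableSet_demand _ _)]
  refine ENNReal.toReal_mono (measure_ne_top _ _) (measure_mono_ae ?_)
  filter_upwards [ae_valueLaw hs] with v hvV hv
  have hb := buys_rev (θ := indices μ p (prominentCosts c i.rev)) (p := p) (v := v) (a := i.rev)
  rw [Fin.rev_rev] at hb
  obtain ⟨⟨h1, h2⟩, h3, h4⟩ := hb.1 hv
  have h5 := h4 (by rw [e1]; exact n1)
  rw [hp, hp'] at h5
  rw [hp'] at h2
  have h6 : indices μ p (prominentCosts c i.rev) i = theta0 μ c - q := by
    rcases e2 with h | h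
    · linarith [(hvV i.rev).1]
    · exact h
  change v i.rev + (q - t) < theta0 μ c ∧ v i.rev + (q - t) < v i.rev.rev
  rw [Fin.rev_rev]
  constructor <;> linarith

end Market

/-! ### The price t*: bounds, monotonicity and semicontinuity. -/

section LowestPrice

set_option linter.unusedSectionVars false

variable {μ : Measure ℝ} [IsProbabilityMeasure μ] {V : ℝ}

lemma secondDemand_eq_integral (θ x : ℝ) :
    secondDemand μ θ x = ∫ s, (if s + x < θ then μ.real (Ioi (s + x)) else 0) ∂μ := by
  rw [secondDemand, measureReal_def, Measure.prod_apply (measurableSet_demand x θ),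
    ← integral_toReal (measurable_measure_prodMk_left (measurableSet_demand x θ)).aemeasurable
      (ae_of_all _ fun _ => measure_lt_top _ _)]
  refine integral_congr_ae (ae_of_all _ fun s => ?_)
  by_cases h : s + x < θ
  · simp [h, measureReal_def, Ioi]
  · simp [h]

lemma secondDemand_nonneg (θ x : ℝ) : 0 ≤ secondDemand μ θ x := measureReal_nonneg

lemma secondDemand_mono {θ θ' : ℝ} (h : θ ≤ θ') (x : ℝ) :
    secondDemand μ θ x ≤ secondDemand μ θ' x :=
  measureReal_mono fun _ hz => ⟨hz.1.trans_le h, hz.2⟩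

lemma secondDemand_le_measureReal (θ x : ℝ) :
    secondDemand μ θ x ≤ μ.real (Iio (θ - x)) := by
  have h : (μ.prod μ).real (Prod.fst ⁻¹' Iio (θ - x)) = μ.real (Iio (θ - x)) :=
    measurePreserving_fst.measureReal_preimage measurableSet_Iio.nullMeasurableSet
  rw [← h]
  exact measureReal_mono fun z hz => lt_sub_iff_add_lt.2 hz.1

lemma secondDemand_eq_zero (hs : ∀ᵐ v ∂μ, v ∈ Icc V (V + 1)) {θ x : ℝ} (h : θ - V ≤ x) :
    secondDemand μ θ x = 0 := by
  refine le_antisymm ((secondDemand_le_measureReal θ x).trans (le_of_eq ?_))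
    (secondDemand_nonneg θ x)
  rw [measureReal_def, measure_eq_zero_iff_ae_notMem.2, ENNReal.toReal_zero]
  filter_upwards [hs] with v hv hv'
  have : v < θ - x := hv'
  linarith [hv.1]

lemma one_sub_cdf (y : ℝ) : 1 - cdf μ y = μ.real (Ioi y) := by
  rw [cdf_eq_real, ← compl_Iic, probReal_compl_eq_one_sub measurableSet_Iic]

/-- Conditioning on the first value gives the integral; the two sides differ only in the endpoint
θ₀(c) - x, a null set. -/
lemma deviationDemand_eq (hs : ∀ᵐ v ∂μ, v ∈ Icc V (V + 1)) [NullSingletonClass μ] (c x : ℝ) :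
    deviationDemand μ V c x = secondDemand μ (theta0 μ c) x := by
  unfold deviationDemand
  split_ifs with h
  · rw [secondDemand_eq_integral, ← integral_indicator measurableSet_Icc]
    have hne : ∀ᵐ v ∂μ, v ≠ theta0 μ c - x := by simp [ae_iff]
    refine integral_congr_ae ?_
    filter_upwards [hs, hne] with s hs hne
    by_cases h' : s + x < theta0 μ c
    · have hm : s ∈ Icc V (theta0 μ c - x) := ⟨hs.1, by linarith⟩
      rw [indicator_of_mem hm, if_pos h', one_sub_cdf]
    · rw [indicator_of_notMem, if_neg h']
      exact fun h2 => h' (by linarith [lt_of_le_of_ne h2.2 hne])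
  · exact (secondDemand_eq_zero hs (not_lt.1 h)).symm

/-- Cut the support into N cells of length 1/N. Two independent values share a cell with probability
∑ pⱼ², which is at least 1/N by Cauchy–Schwarz. -/
lemma inv_nat_le_measureReal_abs_sub_le (hs : ∀ᵐ v ∂μ, v ∈ Icc V (V + 1)) [NullSingletonClass μ]
    {N : ℕ} (hN : 0 < N) :
    1 / (N : ℝ) ≤ (μ.prod μ).real {z | |z.1 - z.2| ≤ 1 / N} := by
  have hN' : (0 : ℝ) < N := by exact_mod_cast hN
  set κ : ℝ → ℤ := fun s => ⌊(s - V) * N⌋ with hκ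
  have hκm : Measurable κ := Int.measurable_floor.comp (by fun_prop)
  set I : ℤ → Set ℝ := fun j => κ ⁻¹' {j} with hI
  have hIm : ∀ j, MeasurableSet (I j) := fun j => hκm (measurableSet_singleton j)
  have hId : Pairwise (Function.onFun Disjoint I) := fun i j hij =>
    Disjoint.preimage κ (disjoint_singleton.2 hij)
  set J := Finset.Ico (0 : ℤ) N with hJ
  have hsum : ∑ j ∈ J, μ.real (I j) = 1 := by
    rw [← measureReal_biUnion_finset (fun i _ j _ hij => hId hij) fun j _ => hIm j]
    -- The right endpoint would fall in an extra cell of index N.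
    have hne : ∀ᵐ v ∂μ, v ≠ V + 1 := by simp [ae_iff]
    have : ∀ᵐ v ∂μ, v ∈ ⋃ j ∈ J, I j := by
      filter_upwards [hs, hne] with v hv hne
      have h1 : v < V + 1 := lt_of_le_of_ne hv.2 hne
      refine mem_biUnion (x := κ v) ?_ rfl
      refine Finset.mem_coe.2 (Finset.mem_Ico.2 ⟨Int.floor_nonneg.2 ?_, Int.floor_lt.2 ?_⟩)
      · exact mul_nonneg (by linarith [hv.1]) hN'.le
      · push_cast
        nlinarith
    rw [measureReal_congr (s := ⋃ j ∈ J, I j) (eventuallyEq_univ.2 this), probReal_univ]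
  have hcard : (J.card : ℝ) = N := by simp [hJ]
  have hcs : (1 : ℝ) ≤ N * ∑ j ∈ J, μ.real (I j) ^ 2 := by
    have := sq_sum_le_card_mul_sum_sq (s := J) (f := fun j => μ.real (I j))
    rw [hsum, hcard] at this
    simpa using this
  have hsub : ⋃ j ∈ J, I j ×ˢ I j ⊆ {z : ℝ × ℝ | |z.1 - z.2| ≤ 1 / N} := by
    refine iUnion₂_subset fun j _ z hz => ?_
    have h1 : κ z.1 = j := hz.1
    have h2 : κ z.2 = j := hz.2
    have h3 := Int.abs_sub_lt_one_of_floor_eq_floor (h1.trans h2.symm)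
    rw [← sub_mul, sub_sub_sub_cancel_right, abs_mul, abs_of_pos hN'] at h3
    exact (le_div_iff₀ hN').2 h3.le
  have hle : ∑ j ∈ J, μ.real (I j) ^ 2 ≤ (μ.prod μ).real {z | |z.1 - z.2| ≤ 1 / N} := by
    refine le_trans (le_of_eq ?_) (measureReal_mono hsub)
    rw [measureReal_biUnion_finset (fun i _ j _ hij => ?_) fun j _ => (hIm j).prod (hIm j)]
    · exact Finset.sum_congr rfl fun j _ => by rw [measureReal_prod_prod, sq]
    · exact Disjoint.set_prod_left (hId hij) _ _
  rw [div_le_iff₀ hN']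
  nlinarith

/-- The events v₁ + x < v₂ and v₂ + x < v₁ are equally likely and disjoint, and both miss |v₁ - v₂|
≤ x. With N = ⌈1/x⌉ the latter has probability at least 1/N ≥ x/(1 + x). Rearranged, x D ≤ 1/2 - D,
which gives t* ≤ 1. -/
lemma secondDemand_le (hs : ∀ᵐ v ∂μ, v ∈ Icc V (V + 1)) [NullSingletonClass μ] (θ : ℝ) {x : ℝ}
    (hx : 0 < x) : secondDemand μ θ x * (1 + x) ≤ 1 / 2 := by
  set A : Set (ℝ × ℝ) := {z | z.1 + x < z.2} with hA
  have hAm : MeasurableSet A :=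
    measurableSet_lt (f := fun z : ℝ × ℝ => z.1 + x) (by fun_prop) measurable_snd
  have hB : (μ.prod μ).real (Prod.swap ⁻¹' A) = (μ.prod μ).real A :=
    Measure.measurePreserving_swap.measureReal_preimage hAm.nullMeasurableSet
  set N := ⌈1 / x⌉₊ with hN
  have hN0 : 0 < N := Nat.ceil_pos.2 (by positivity)
  have hN0' : (0 : ℝ) < N := by exact_mod_cast hN0
  have hN1 : (N : ℝ) < 1 / x + 1 := Nat.ceil_lt_add_one (by positivity)
  have hN2 : 1 / (N : ℝ) ≤ x := by
    rw [div_le_comm₀ hN0' hx]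
    exact Nat.le_ceil _
  have hE : 1 / (N : ℝ) ≤ (μ.prod μ).real (A ∪ Prod.swap ⁻¹' A)ᶜ := by
    refine (inv_nat_le_measureReal_abs_sub_le hs hN0).trans (measureReal_mono fun z hz => ?_)
    have h1 := abs_le.1 ((show |z.1 - z.2| ≤ 1 / N from hz).trans hN2)
    rintro (h | h)
    · have : z.1 + x < z.2 := h
      linarith
    · have : z.2 + x < z.1 := h
      linarith
  have hd : Disjoint A (Prod.swap ⁻¹' A) := disjoint_left.2 fun z h h' => by
    have h1 : z.1 + x < z.2 := h
    have h2 : z.2 + x < z.1 := h'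
    linarith
  rw [probReal_compl_eq_one_sub (hAm.union (measurable_swap hAm)),
    measureReal_union hd (measurable_swap hAm), hB] at hE
  have hle : secondDemand μ θ x ≤ (μ.prod μ).real A := measureReal_mono fun z hz => hz.2
  have hN3 : x / (1 + x) ≤ 1 / N := by
    rw [div_le_div_iff₀ (by linarith) hN0']
    have := mul_lt_mul_of_pos_left hN1 hx
    rw [mul_add, mul_one_div_cancel hx.ne'] at this
    linarith
  have h2 : secondDemand μ θ x ≤ (1 - x / (1 + x)) / 2 := by linarith
  calc secondDemand μ θ x * (1 + x) ≤ (1 - x / (1 + x)) / 2 * (1 + x) := by gcongr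
    _ = 1 / 2 := by field_simp; ring

lemma secondDemand_lt_half (hs : ∀ᵐ v ∂μ, v ∈ Icc V (V + 1)) [NullSingletonClass μ] (θ : ℝ)
    {x : ℝ} (hx : 0 < x) : secondDemand μ θ x < 1 / 2 := by
  have h1 := secondDemand_le hs θ hx
  have h2 := secondDemand_nonneg (μ := μ) θ x
  rcases h2.eq_or_lt with h | h
  · rw [← h]; norm_num
  · nlinarith

lemma tStar_le (hs : ∀ᵐ v ∂μ, v ∈ Icc V (V + 1)) [NullSingletonClass μ] {c r : ℝ}
    (h : ∀ x, 0 < x → x * secondDemand μ (theta0 μ c) x ≤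
      r * (1 / 2 - secondDemand μ (theta0 μ c) x)) : tStar μ V c ≤ r := by
  refine csSup_le (nonempty_Ioi.image _) ?_
  rintro _ ⟨x, hx, rfl⟩
  simp only [deviationDemand_eq hs]
  exact (div_le_iff₀ (sub_pos.2 (secondDemand_lt_half hs _ hx))).2 (h x hx)

lemma mul_secondDemand_le (hs : ∀ᵐ v ∂μ, v ∈ Icc V (V + 1)) [NullSingletonClass μ] (c : ℝ) {x : ℝ}
    (hx : 0 < x) : x * secondDemand μ (theta0 μ c) x ≤
      1 * (1 / 2 - secondDemand μ (theta0 μ c) x) := by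
  linarith [secondDemand_le hs (theta0 μ c) hx]

lemma tStar_le_one (hs : ∀ᵐ v ∂μ, v ∈ Icc V (V + 1)) [NullSingletonClass μ] (c : ℝ) :
    tStar μ V c ≤ 1 := tStar_le hs fun _ hx => mul_secondDemand_le hs c hx

lemma le_tStar (hs : ∀ᵐ v ∂μ, v ∈ Icc V (V + 1)) [NullSingletonClass μ] (c : ℝ) {x : ℝ}
    (hx : 0 < x) : x * secondDemand μ (theta0 μ c) x / (1 / 2 - secondDemand μ (theta0 μ c) x) ≤
      tStar μ V c := by
  rw [← deviationDemand_eq hs]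
  refine le_csSup ⟨1, ?_⟩ ⟨x, hx, rfl⟩
  rintro _ ⟨y, hy, rfl⟩
  simp only [deviationDemand_eq hs]
  exact (div_le_iff₀ (sub_pos.2 (secondDemand_lt_half hs _ hy))).2 (mul_secondDemand_le hs c hy)

lemma mul_secondDemand_le_tStar (hs : ∀ᵐ v ∂μ, v ∈ Icc V (V + 1)) [NullSingletonClass μ] (c : ℝ)
    {x : ℝ} (hx : 0 < x) :
    x * secondDemand μ (theta0 μ c) x ≤
      tStar μ V c * (1 / 2 - secondDemand μ (theta0 μ c) x) :=
  (div_le_iff₀ (sub_pos.2 (secondDemand_lt_half hs _ hx))).1 (le_tStar hs c hx)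

lemma tStar_nonneg (hs : ∀ᵐ v ∂μ, v ∈ Icc V (V + 1)) [NullSingletonClass μ] (c : ℝ) :
    0 ≤ tStar μ V c :=
  (div_nonneg (mul_nonneg zero_le_one (secondDemand_nonneg _ _))
    (sub_nonneg.2 (secondDemand_lt_half hs _ one_pos).le)).trans (le_tStar hs c one_pos)

lemma tStar_antitone (hs : ∀ᵐ v ∂μ, v ∈ Icc V (V + 1)) [NullSingletonClass μ] {c d : ℝ}
    (hc : 0 ≤ c) (h : c ≤ d) : tStar μ V d ≤ tStar μ V c := by
  refine tStar_le hs fun x hx => ?_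
  have h1 := secondDemand_mono (μ := μ) (theta0_antitoneOn hs hc h) x
  calc x * secondDemand μ (theta0 μ d) x ≤ x * secondDemand μ (theta0 μ c) x := by gcongr
    _ ≤ tStar μ V c * (1 / 2 - secondDemand μ (theta0 μ c) x) := mul_secondDemand_le_tStar hs c hx
    _ ≤ _ := mul_le_mul_of_nonneg_left (by linarith) (tStar_nonneg hs c)

lemma tStar_cBar (hs : ∀ᵐ v ∂μ, v ∈ Icc V (V + 1)) [NullSingletonClass μ] :
    tStar μ V (cBar μ V) = 0 := by
  refine le_antisymm (tStar_le hs fun x hx => ?_) (tStar_nonneg hs _)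
  rw [secondDemand_eq_zero hs (by rw [theta0_cBar hs]; linarith)]
  simp

lemma tStar_le_sub (hs : ∀ᵐ v ∂μ, v ∈ Icc V (V + 1)) [NullSingletonClass μ] {c : ℝ}
    (hV : V ≤ theta0 μ c) (h : μ.real (Iic (theta0 μ c)) ≤ 1 / 4) :
    tStar μ V c ≤ theta0 μ c - V := by
  refine tStar_le hs fun x hx => ?_
  rcases le_or_gt (theta0 μ c - V) x with h1 | h1
  · rw [secondDemand_eq_zero hs h1]; linarith
  · have h2 : secondDemand μ (theta0 μ c) x ≤ 1 / 4 :=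
      (secondDemand_le_measureReal _ _).trans ((measureReal_mono fun v hv => by
        have : v < theta0 μ c - x := hv
        exact (show v ≤ theta0 μ c by linarith)).trans h)
    exact mul_le_mul h1.le (by linarith) (secondDemand_nonneg _ _) (by linarith)

/-- The demand is right continuous in the cost: s + x < θ₀(b) reads b < g(s + x), and this strict
condition is stable as b decreases to c. Dominated convergence concludes. -/
lemma exists_gt_lt_secondDemand (hs : ∀ᵐ v ∂μ, v ∈ Icc V (V + 1)) {c d x : ℝ} (hc : 0 ≤ c)
    (h : d < secondDemand μ (theta0 μ c) x) :
    ∃ c' > c, d < secondDemand μ (theta0 μ c') x := by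
  have hint : ∀ b, 0 ≤ b → secondDemand μ (theta0 μ b) x =
      ∫ s, (if b < searchGain μ (s + x) then μ.real (Ioi (s + x)) else 0) ∂μ := fun b hb => by
    rw [secondDemand_eq_integral]
    simp_rw [lt_theta0_iff hs hb]
  have hg := (continuous_searchGain hs).measurable
  have hm : Measurable fun s : ℝ => μ.real (Ioi (s + x)) := by
    simp_rw [← one_sub_cdf]
    exact measurable_const.sub ((cdf μ).mono.measurable.comp (by fun_prop))
  have ht : Tendsto (fun b => secondDemand μ (theta0 μ b) x) (𝓝[>] c)
      (𝓝 (secondDemand μ (theta0 μ c) x)) := by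
    rw [hint c hc]
    refine Tendsto.congr' (f₁ := fun b =>
      ∫ s, (if b < searchGain μ (s + x) then μ.real (Ioi (s + x)) else 0) ∂μ) ?_
      (tendsto_integral_filter_of_dominated_convergence (fun _ => 1) ?_ ?_ (integrable_const _) ?_)
    · filter_upwards [self_mem_nhdsWithin] with b hb
      exact (hint b (hc.trans (le_of_lt hb))).symm
    · exact Eventually.of_forall fun b => (Measurable.ite
        (measurableSet_lt measurable_const (hg.comp (by fun_prop))) hm
        measurable_const).aestronglyMeasurable
    · refine Eventually.of_forall fun b => ae_of_all _ fun s => ?_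
      split_ifs
      · rw [Real.norm_of_nonneg measureReal_nonneg]; exact measureReal_le_one
      · simp
    · refine ae_of_all _ fun s => ?_
      refine tendsto_const_nhds.congr' ?_
      by_cases h : c < searchGain μ (s + x)
      · filter_upwards [nhdsWithin_le_nhds (gt_mem_nhds h)] with b hb
        rw [if_pos h, if_pos hb]
      · filter_upwards [self_mem_nhdsWithin] with b hb
        rw [if_neg h, if_neg fun h' => h (lt_trans hb h')]
  obtain ⟨c', h1, h2⟩ := ((ht.eventually (lt_mem_nhds h)).and self_mem_nhdsWithin).exists
  exact ⟨c', h2, h1⟩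

/-- A deviation x that certifies t*(c) > y still does so at some c' > c, and hence at every cost in
[0, c'], since demand falls with cost. -/
lemma lowerSemicontinuousOn_tStar (hs : ∀ᵐ v ∂μ, v ∈ Icc V (V + 1)) [NullSingletonClass μ] :
    LowerSemicontinuousOn (tStar μ V) (Ici 0) := by
  intro c hc y hy
  rcases lt_or_ge y 0 with hy0 | hy0
  · exact Eventually.of_forall fun d => hy0.trans_le (tStar_nonneg hs d)
  obtain ⟨_, ⟨x, hx, rfl⟩, hlt⟩ := exists_lt_of_lt_csSup (nonempty_Ioi.image _) hy
  have hx : 0 < x := hx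
  simp only [deviationDemand_eq hs] at hlt
  rw [lt_div_iff₀ (sub_pos.2 (secondDemand_lt_half hs _ hx))] at hlt
  -- This is y < x D/(1/2 - D) solved for D.
  have h1 : y / 2 / (x + y) < secondDemand μ (theta0 μ c) x := by
    rw [div_lt_iff₀ (by linarith)]; linarith
  obtain ⟨c', hc', h2⟩ := exists_gt_lt_secondDemand hs hc h1
  filter_upwards [self_mem_nhdsWithin, nhdsWithin_le_nhds (gt_mem_nhds hc')] with d hd hd'
  have h3 := h2.trans_le (secondDemand_mono (theta0_antitoneOn hs hd (le_of_lt hd')) x)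
  rw [div_lt_iff₀ (by linarith)] at h3
  refine lt_of_lt_of_le ?_ (le_tStar hs d hx)
  rw [lt_div_iff₀ (sub_pos.2 (secondDemand_lt_half hs _ hx))]
  linarith

lemma continuous_searchWelfare (hs : ∀ᵐ v ∂μ, v ∈ Icc V (V + 1)) :
    Continuous (searchWelfare μ) := by
  have hg := continuous_searchGain hs
  refine continuous_const.add (LipschitzWith.of_dist_le_mul (K := 1) fun x y => ?_).continuous
  have hi : ∀ c, Integrable (fun v => max (searchGain μ v - c) 0) μ := fun c =>
    integrable_of_continuous hs (by fun_prop)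
  rw [Real.dist_eq, ← integral_sub (hi x) (hi y), NNReal.coe_one, one_mul, ← Real.norm_eq_abs]
  refine (norm_integral_le_of_norm_le_const (C := dist x y) (ae_of_all _ fun v => ?_)).trans
    (by simp)
  rw [Real.norm_eq_abs, Real.dist_eq]
  refine (abs_max_sub_max_le_abs _ _ _).trans ?_
  rw [sub_sub_sub_cancel_left, abs_sub_comm]

lemma le_searchWelfare (c : ℝ) : ∫ v, v ∂μ ≤ searchWelfare μ c :=
  le_add_of_nonneg_right (integral_nonneg fun _ => le_max_right _ _)

lemma searchWelfare_cBar (hs : ∀ᵐ v ∂μ, v ∈ Icc V (V + 1)) :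
    searchWelfare μ (cBar μ V) = ∫ v, v ∂μ := by
  have : ∫ v, max (searchGain μ v - cBar μ V) 0 ∂μ = ∫ v, (0 : ℝ) ∂μ :=
    integral_congr_ae (hs.mono fun v hv => max_eq_right (by
      have := searchGain_antitone hs hv.1
      rw [cBar_eq]; linarith))
  rw [searchWelfare, this]
  simp

lemma surplusAtTStar_eq (hs : ∀ᵐ v ∂μ, v ∈ Icc V (V + 1)) [NullSingletonClass μ] (hV : 1 ≤ V)
    {c : ℝ} (hc : c ∈ Icc 0 (cBar μ V)) :
    surplusAtTStar μ V c = searchWelfare μ c - tStar μ V c :=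
  average_const (by norm_num) fun w =>
    buyerUtility_const hs hc.1 hc.2 ((tStar_le_one hs c).trans hV) w

lemma welfareAtTStar_eq (hs : ∀ᵐ v ∂μ, v ∈ Icc V (V + 1)) [NullSingletonClass μ] (hV : 1 ≤ V)
    {c : ℝ} (hc : c ∈ Icc 0 (cBar μ V)) :
    welfareAtTStar μ V c = searchWelfare μ c :=
  average_const (by norm_num) fun w =>
    expectedWelfare_const hs hc.1 hc.2 ((tStar_le_one hs c).trans hV) w

end LowestPrice

/-! ### Equilibrium bounds, implementation of t*, limits and the maximum. -/

section Equilibrium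

set_option linter.unusedSectionVars false

variable {μ : Measure ℝ} [IsProbabilityMeasure μ] {V : ℝ}

lemma purchaseProb_nonneg (p k : Fin 2 → ℝ) (i : Fin 2) : 0 ≤ purchaseProb μ p k i :=
  le_sum_firstProb_mul fun _ => measureReal_nonneg

lemma IsStandard.alloc_eq_half {c t : ℝ} {M : ProminenceMechanism} (hM : IsStandard μ c M)
    (he : IsEquilibrium μ c M fun _ => t) : M.alloc (fun _ => t) = fun _ => 1 / 2 := by
  have h1 := hM.2 t he
  have h2 := hM.1 (Equiv.swap 0 1) (fun _ => t) 0
  rw [Equiv.swap_apply_left] at h2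
  rw [Fin.sum_univ_two] at h1
  ext i
  fin_cases i <;> simp <;> linarith

lemma IsEquilibrium.price_nonneg (hs : ∀ᵐ v ∂μ, v ∈ Icc V (V + 1)) {c t : ℝ} (hc : 0 < c)
    (hcc : c ≤ cBar μ V) (hV : 0 ≤ V) {M : ProminenceMechanism} (hM : IsStandard μ c M)
    (he : IsEquilibrium μ c M fun _ => t) : 0 ≤ t := by
  by_contra! h
  have h1 := he 0 0
  rw [revenue, revenue, hM.alloc_eq_half he,
    average_half_purchaseProb hs hc hcc (h.le.trans hV), Function.update_self] at h1
  linarith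

/-- The deviation to t + x sells at least D_c(x) under every allocation of prominence, so (t + x)
D_c(x) ≤ t/2. Prices above V are covered by t* ≤ 1 ≤ V. -/
lemma IsEquilibrium.tStar_le (hs : ∀ᵐ v ∂μ, v ∈ Icc V (V + 1)) [NullSingletonClass μ]
    {c t : ℝ} (hc : 0 < c) (hcc : c ≤ cBar μ V) (hV : 1 ≤ V) {M : ProminenceMechanism}
    (hM : IsStandard μ c M) (he : IsEquilibrium μ c M fun _ => t) : tStar μ V c ≤ t := by
  rcases lt_or_ge V t with ht | ht
  · exact (tStar_le_one hs c).trans (hV.trans ht.le)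
  have ht0 := he.price_nonneg hs hc hcc (zero_le_one.trans hV) hM
  refine ProminenceMarket.tStar_le hs fun x hx => ?_
  have h1 := he 0 (t + x)
  have h2 : secondDemand μ (theta0 μ c) x ≤
      average c (M.alloc (Function.update (fun _ => t) 0 (t + x))) fun k =>
        purchaseProb μ (Function.update (fun _ => t) 0 (t + x)) k 0 := by
    refine le_average (M.alloc_nonneg _) (M.sum_alloc_le_one _) (fun w => ?_) ?_
    · exact secondDemand_le_purchaseProb hs ht (Function.update_self _ _ _)
        (Function.update_of_ne (rev_ne 0) _ _) (prominentCosts_nonneg hc.le w)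
        (prominentCosts_le hc.le w)
    · exact secondDemand_le_purchaseProb hs ht (Function.update_self _ _ _)
        (Function.update_of_ne (rev_ne 0) _ _) (fun _ => hc.le) fun _ => le_rfl
  rw [revenue, revenue, hM.alloc_eq_half he, average_half_purchaseProb hs hc hcc ht,
    Function.update_self] at h1
  have h3 := mul_le_mul_of_nonneg_left h2 (by linarith : 0 ≤ t + x)
  linarith

lemma surplusAtTStar_mem_upperBounds (hs : ∀ᵐ v ∂μ, v ∈ Icc V (V + 1)) [NullSingletonClass μ]
    (hV : 2 ≤ V) {c : ℝ} (hc : c ∈ Ioo 0 (cBar μ V)) :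
    surplusAtTStar μ V c ∈ upperBounds (achievableSurplus μ c) := by
  rintro s ⟨M, t, hM, he, rfl⟩
  rw [surplusAtTStar_eq hs (by linarith) ⟨hc.1.le, hc.2.le⟩, hM.alloc_eq_half he]
  rcases le_or_gt t V with ht | ht
  · rw [average_const (by norm_num) fun w => buyerUtility_const hs hc.1.le hc.2.le ht w]
    linarith [he.tStar_le hs hc.1 hc.2.le (by linarith) hM]
  · have : average c (fun _ => 1 / 2) (fun k => buyerUtility μ (fun _ => t) k) ≤ 1 := by
      have h := fun w => buyerUtility_le_one hs ht.le (prominentCosts_nonneg hc.1.le w)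
      rw [average_eq (by norm_num), Fin.sum_univ_two]
      linarith [h 0, h 1]
    -- Here V ≥ 2 matters: W(c) - t* ≥ V - 1 ≥ 1.
    linarith [tStar_le_one hs c, le_searchWelfare (μ := μ) c, le_integral_value hs]

/-- The mechanism that supports the price `t`: a seller who deviates from it loses prominence
to the other one. -/
noncomputable def punishDeviations (t : ℝ) : ProminenceMechanism where
  alloc p i := if p i = p i.rev then 1 / 2 else if p i.rev = t then 0
    else if p i = t then 1 else 1 / 2
  alloc_nonneg p i := by split_ifs <;> norm_num
  sum_alloc_le_one p := by
    rw [Fin.sum_univ_two]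
    have h0 : Fin.rev (0 : Fin 2) = 1 := rfl
    have h1 : Fin.rev (1 : Fin 2) = 0 := rfl
    rw [h0, h1]
    by_cases h : p 0 = p 1
    · simp only [h, if_true]; norm_num
    · simp only [h, Ne.symm h, if_false]
      split_ifs <;> norm_num

lemma isStandard_punishDeviations (c t : ℝ) : IsStandard μ c (punishDeviations t) := by
  constructor
  · intro σ p i
    have h2 : ∀ (σ : Equiv.Perm (Fin 2)) (i : Fin 2), σ (σ i) = i ∧ (σ i).rev = σ i.rev := by
      decide
    simp only [punishDeviations, (h2 σ i).1, (h2 σ i).2, (h2 σ i.rev).1]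
  · intro s _
    simp [punishDeviations]

/-- By `hθ` even a price of 0 leaves the deviator second in the order of search. Then `hF` caps
demand after undercutting at 1/2, and `hx` rules out upward deviations. -/
lemma isEquilibrium_punishDeviations (hs : ∀ᵐ v ∂μ, v ∈ Icc V (V + 1)) {c t : ℝ} (hc : 0 < c)
    (hcc : c ≤ cBar μ V) (ht : t ≤ V) (ht0 : 0 ≤ t) (hθ : t < theta0 μ 0 - theta0 μ c)
    (hF : μ.real (Iic (theta0 μ c + t)) ≤ 1 / 2)
    (hx : ∀ x, 0 < x → (t + x) * secondDemand μ (theta0 μ c) x ≤ t * (1 / 2)) :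
    IsEquilibrium μ c (punishDeviations t) fun _ => t := by
  intro i q
  have heq : revenue μ c (punishDeviations t) (fun _ => t) i = t * (1 / 2) := by
    have : (punishDeviations t).alloc (fun _ => t) = fun _ => 1 / 2 := by
      ext j; simp [punishDeviations]
    rw [revenue, this, average_half_purchaseProb hs hc hcc ht]
  rcases eq_or_ne q t with rfl | hqt
  · rw [Function.update_eq_self i (fun _ : Fin 2 => q)]
  set p := Function.update (fun _ : Fin 2 => t) i q with hp
  have p1 : p i = q := Function.update_self _ _ _
  have p2 : p i.rev = t := Function.update_of_ne (rev_ne i) _ _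
  have hrev : revenue μ c (punishDeviations t) p i =
      q * purchaseProb μ p (prominentCosts c i.rev) i := by
    have a1 : (punishDeviations t).alloc p i = 0 := by simp [punishDeviations, p1, p2, hqt]
    have a2 : (punishDeviations t).alloc p i.rev = 1 := by
      simp [punishDeviations, p1, p2, hqt, Ne.symm hqt]
    rw [revenue, average_eq (by rw [sum_eq_add_rev _ i, a1, a2, zero_add]), sum_eq_add_rev _ i,
      a1, a2, p1]
    simp
  rw [heq, hrev]
  rcases lt_or_ge q 0 with hq | hq
  · have := mul_nonpos_of_nonpos_of_nonneg hq.le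
      (purchaseProb_nonneg (μ := μ) p (prominentCosts c i.rev) i)
    linarith
  have hle := purchaseProb_le_secondDemand hs hc hcc ht p1 p2 (by linarith)
  refine (mul_le_mul_of_nonneg_left hle hq).trans ?_
  rcases hqt.lt_or_gt with h | h
  · have h1 : secondDemand μ (theta0 μ c) (q - t) ≤ 1 / 2 :=
      (secondDemand_le_measureReal _ _).trans ((measureReal_mono fun v hv => by
        have : v < theta0 μ c - (q - t) := hv
        exact (show v ≤ theta0 μ c + t by linarith)).trans hF)
    exact mul_le_mul h.le h1 (secondDemand_nonneg _ _) ht0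
  · simpa using hx (q - t) (sub_pos.2 h)

lemma isLeast_and_isGreatest (hs : ∀ᵐ v ∂μ, v ∈ Icc V (V + 1)) [NullSingletonClass μ]
    (hV : 2 ≤ V) {c : ℝ} (hc : c ∈ Ioo 0 (cBar μ V))
    (hθ : tStar μ V c < theta0 μ 0 - theta0 μ c)
    (hF : μ.real (Iic (theta0 μ c + tStar μ V c)) ≤ 1 / 2) :
    IsLeast (implementablePrices μ c) (tStar μ V c) ∧
      IsGreatest (achievableSurplus μ c) (surplusAtTStar μ V c) := by
  have hst := isStandard_punishDeviations (μ := μ) c (tStar μ V c)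
  have heq := isEquilibrium_punishDeviations hs hc.1 hc.2.le
    ((tStar_le_one hs c).trans (by linarith)) (tStar_nonneg hs c) hθ hF fun x hx => by
      linarith [mul_secondDemand_le_tStar hs c hx]
  refine ⟨⟨⟨_, hst, heq⟩, ?_⟩, ⟨_, _, hst, heq, ?_⟩, surplusAtTStar_mem_upperBounds hs hV hc⟩
  · rintro t ⟨M, hM, he⟩
    exact he.tStar_le hs hc.1 hc.2.le (by linarith) hM
  · rw [hst.alloc_eq_half heq, surplusAtTStar]

lemma tendsto_measureReal_Iic (hs : ∀ᵐ v ∂μ, v ∈ Icc V (V + 1)) [NullSingletonClass μ] :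
    Tendsto (fun y => μ.real (Iic y)) (𝓝[>] V) (𝓝 0) := by
  have h0 : cdf μ V = 0 := by
    rw [cdf_eq_real, measureReal_def, measure_eq_zero_iff_ae_notMem.2, ENNReal.toReal_zero]
    have hne : ∀ᵐ v ∂μ, v ≠ V := by simp [ae_iff]
    filter_upwards [hs, hne] with v hv hne hv'
    exact hne (le_antisymm hv' hv.1)
  have h := ((cdf μ).right_continuous V).tendsto
  rw [h0] at h
  simp_rw [← cdf_eq_real]
  exact h.mono_left (nhdsWithin_mono _ Ioi_subset_Ici_self)

lemma eventually_tStar_le_sub (hs : ∀ᵐ v ∂μ, v ∈ Icc V (V + 1)) [NullSingletonClass μ] :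
    ∀ᶠ c in 𝓝[<] (cBar μ V), tStar μ V c ≤ theta0 μ c - V := by
  have h1 := (tendsto_measureReal_Iic hs).comp (tendsto_theta0_cBar hs)
  filter_upwards [h1.eventually (gt_mem_nhds (by norm_num : (0 : ℝ) < 1 / 4)),
    (tendsto_theta0_cBar hs).eventually self_mem_nhdsWithin] with c h2 h3
  exact tStar_le_sub hs (le_of_lt h3) h2.le

lemma tendsto_tStar_cBar (hs : ∀ᵐ v ∂μ, v ∈ Icc V (V + 1)) [NullSingletonClass μ] :
    Tendsto (tStar μ V) (𝓝[<] (cBar μ V)) (𝓝 0) := by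
  have h : Tendsto (fun c => theta0 μ c - V) (𝓝[<] (cBar μ V)) (𝓝 0) := by
    have := ((tendsto_theta0_cBar hs).mono_right nhdsWithin_le_nhds).sub_const V
    rwa [sub_self] at this
  exact tendsto_of_tendsto_of_tendsto_of_le_of_le' tendsto_const_nhds h
    (Eventually.of_forall (tStar_nonneg hs)) (eventually_tStar_le_sub hs)

lemma tendsto_tStar_zero (hs : ∀ᵐ v ∂μ, v ∈ Icc V (V + 1)) [NullSingletonClass μ] :
    Tendsto (tStar μ V) (𝓝[>] 0) (𝓝 (tStar μ V 0)) := by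
  refine tendsto_order.2 ⟨fun y hy => ?_, fun y hy => ?_⟩
  · exact (lowerSemicontinuousOn_tStar hs 0 self_mem_Ici y hy).filter_mono
      (nhdsWithin_mono _ Ioi_subset_Ici_self)
  · filter_upwards [self_mem_nhdsWithin] with c hc
    exact (tStar_antitone hs le_rfl (le_of_lt hc)).trans_lt hy

lemma eventually_isLeast_and_isGreatest (hs : ∀ᵐ v ∂μ, v ∈ Icc V (V + 1)) [NullSingletonClass μ]
    (hV : 2 ≤ V) : ∀ᶠ c in 𝓝[<] (cBar μ V),
      IsLeast (implementablePrices μ c) (tStar μ V c) ∧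
        IsGreatest (achievableSurplus μ c) (surplusAtTStar μ V c) := by
  have hθ := tendsto_theta0_cBar hs (μ := μ)
  have hθ' := hθ.mono_right nhdsWithin_le_nhds
  have ht := tendsto_tStar_cBar hs (μ := μ)
  have h1 : Tendsto (fun c => theta0 μ c + tStar μ V c) (𝓝[<] (cBar μ V)) (𝓝[>] V) := by
    refine tendsto_nhdsWithin_iff.2 ⟨by simpa using hθ'.add ht, ?_⟩
    filter_upwards [hθ.eventually self_mem_nhdsWithin] with c hc
    exact lt_of_lt_of_le hc (by linarith [tStar_nonneg hs (μ := μ) c])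
  have h2 := (tendsto_measureReal_Iic hs).comp h1
  have h3 : V < theta0 μ 0 := lt_theta0 hs le_rfl (cBar_pos hs)
  have h4 : Tendsto (fun c => theta0 μ c + tStar μ V c) (𝓝[<] (cBar μ V)) (𝓝 V) :=
    h1.mono_right nhdsWithin_le_nhds
  filter_upwards [h2.eventually (gt_mem_nhds (by norm_num : (0 : ℝ) < 1 / 2)),
    h4.eventually (gt_mem_nhds h3), self_mem_nhdsWithin,
    nhdsWithin_le_nhds (lt_mem_nhds (cBar_pos hs))] with c e1 e2 e3 e4
  exact isLeast_and_isGreatest hs hV ⟨e4, e3⟩ (by linarith) (le_of_lt e1)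

lemma tendsto_surplusAtTStar_zero (hs : ∀ᵐ v ∂μ, v ∈ Icc V (V + 1)) [NullSingletonClass μ]
    (hV : 1 ≤ V) :
    Tendsto (surplusAtTStar μ V) (𝓝[>] 0) (𝓝 (surplusAtTStar μ V 0)) := by
  have hpos := cBar_pos hs (μ := μ)
  rw [surplusAtTStar_eq hs hV ⟨le_rfl, hpos.le⟩]
  refine Tendsto.congr' ?_ ((((continuous_searchWelfare hs).tendsto 0).mono_left
    nhdsWithin_le_nhds).sub (tendsto_tStar_zero hs))
  filter_upwards [self_mem_nhdsWithin, nhdsWithin_le_nhds (gt_mem_nhds hpos)] with c h1 h2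
  exact (surplusAtTStar_eq hs hV ⟨le_of_lt h1, le_of_lt h2⟩).symm

lemma tendsto_surplusAtTStar_cBar (hs : ∀ᵐ v ∂μ, v ∈ Icc V (V + 1)) [NullSingletonClass μ]
    (hV : 1 ≤ V) :
    Tendsto (surplusAtTStar μ V) (𝓝[<] (cBar μ V)) (𝓝 (∫ v, v ∂μ)) := by
  have h := (((continuous_searchWelfare hs).tendsto (cBar μ V)).mono_left
    nhdsWithin_le_nhds).sub (tendsto_tStar_cBar hs)
  rw [searchWelfare_cBar hs, sub_zero] at h
  refine Tendsto.congr' ?_ h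
  filter_upwards [self_mem_nhdsWithin, nhdsWithin_le_nhds (lt_mem_nhds (cBar_pos hs))] with c h1 h2
  exact (surplusAtTStar_eq hs hV ⟨le_of_lt h2, le_of_lt h1⟩).symm

/-- t* - W is lower semicontinuous on a compact interval. The minimizer is not c̄, where the surplus
equals E[v], since nearby costs do strictly better. -/
lemma exists_isMax_surplusAtTStar (hs : ∀ᵐ v ∂μ, v ∈ Icc V (V + 1)) [NullSingletonClass μ]
    (hV : 1 ≤ V) (h : ∀ᶠ c in 𝓝[<] (cBar μ V), ∫ v, v ∂μ < surplusAtTStar μ V c) :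
    ∃ c' ∈ Ico 0 (cBar μ V),
      (∀ c ∈ Icc 0 (cBar μ V), surplusAtTStar μ V c ≤ surplusAtTStar μ V c') ∧
      ∫ v, v ∂μ < surplusAtTStar μ V c' := by
  have hpos := cBar_pos hs (μ := μ)
  have hlsc : LowerSemicontinuousOn (fun c => tStar μ V c + -searchWelfare μ c)
      (Icc 0 (cBar μ V)) :=
    ((lowerSemicontinuousOn_tStar hs).mono fun _ hc => hc.1).add
      ((continuous_searchWelfare hs).fun_neg.lowerSemicontinuous.lowerSemicontinuousOn _)
  obtain ⟨c', hc', hmin⟩ := hlsc.exists_isMinOn (nonempty_Icc.2 hpos.le) isCompact_Icc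
  have hmax : ∀ c ∈ Icc 0 (cBar μ V), surplusAtTStar μ V c ≤ surplusAtTStar μ V c' := by
    intro c hc
    have : tStar μ V c' + -searchWelfare μ c' ≤ tStar μ V c + -searchWelfare μ c := hmin hc
    rw [surplusAtTStar_eq hs hV hc, surplusAtTStar_eq hs hV hc']
    linarith
  obtain ⟨d, hd, hd1, hd2⟩ := (h.and (eventually_mem_nhdsWithin.and
    (nhdsWithin_le_nhds (lt_mem_nhds hpos)))).exists
  have hlt := hd.trans_le (hmax d ⟨le_of_lt hd2, le_of_lt hd1⟩)
  refine ⟨c', ⟨hc'.1, lt_of_le_of_ne hc'.2 fun heq => ?_⟩, hmax, hlt⟩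
  rw [heq, surplusAtTStar_eq hs hV ⟨hpos.le, le_rfl⟩, searchWelfare_cBar hs, tStar_cBar hs] at hlt
  linarith

end Equilibrium

/-! ### Polynomial estimates for the third-order comparison. -/

lemma integral_cubic (c₀ c₁ c₂ c₃ x y : ℝ) :
    ∫ s in x..y, (c₀ + c₁ * s + c₂ * s ^ 2 + c₃ * s ^ 3) = c₀ * (y - x) +
      c₁ * (y ^ 2 - x ^ 2) / 2 + c₂ * (y ^ 3 - x ^ 3) / 3 + c₃ * (y ^ 4 - x ^ 4) / 4 := by
  rw [intervalIntegral.integral_eq_sub_of_hasDerivAt (f := fun s => c₀ * s + c₁ * s ^ 2 / 2 +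
    c₂ * s ^ 3 / 3 + c₃ * s ^ 4 / 4) (fun s _ => ?_)
    (Continuous.intervalIntegrable (by fun_prop) _ _)]
  · ring
  · exact (((((hasDerivAt_id s).const_mul c₀).add
      (((hasDerivAt_pow 2 s).const_mul c₁).div_const 2)).add
      (((hasDerivAt_pow 3 s).const_mul c₂).div_const 3)).add
      (((hasDerivAt_pow 4 s).const_mul c₃).div_const 4)).congr_deriv (by push_cast; ring)

/-- The scaled form of the bound on the deviation payoff: `u` is the size of the deviation
relative to `δ`. -/
lemma exists_forall_scaled_le {a β γ : ℝ} (ha : 0 ≤ a) (hβ : 0 ≤ β) (hγ : 0 ≤ γ)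
    (h0 : a = 0 → 4 / 27 * β < γ) (h1 : 0 < a → β / 8 + a ^ 2 / 8 < γ) :
    ∃ δ₀ > 0, ∀ δ, 0 < δ → δ < δ₀ → ∀ u, 0 ≤ u → u ≤ 1 →
      (a * (1 - u) + δ * (β * (1 - u) ^ 2 / 2 - a ^ 2 * (1 - u) ^ 2 / 2 - a ^ 2 * u * (1 - u))) *
        (u + δ * (a / 2 + γ * δ)) ≤ a / 4 + γ * δ / 2 := by
  set C := γ * a + β / 2 * (a / 2 + γ) with hC
  have hC0 : 0 ≤ C := by positivity
  -- The terms up to first order in δ leave a slack of at least κδ - Kδ², uniformly in u; C bounds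
  -- the coefficient of δ² in the product.
  obtain ⟨K, κ, hκ, hK, hmain⟩ : ∃ K κ : ℝ, 0 < κ ∧ 0 ≤ K ∧ ∀ δ u : ℝ, 0 < δ → 0 ≤ u → u ≤ 1 →
      δ * κ - δ ^ 2 * K ≤ a / 4 + γ * δ / 2 - a * (1 - u) * u -
        δ * ((β * (1 - u) ^ 2 / 2 - a ^ 2 * (1 - u) ^ 2 / 2 - a ^ 2 * u * (1 - u)) * u +
          a ^ 2 * (1 - u) / 2) := by
    rcases ha.eq_or_lt with rfl | ha
    -- With a = 0 only β u(1 - u)²/2 remains, maximal at u = 1/3.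
    · refine ⟨0, γ / 2 - 2 / 27 * β, by linarith [h0 rfl], le_rfl, fun δ u hδ hu0 hu1 => ?_⟩
      have h2 : u * (1 - u) ^ 2 ≤ 4 / 27 := by
        nlinarith [mul_nonneg (sq_nonneg (u - 1 / 3)) (by linarith : 0 ≤ 4 / 3 - u)]
      have h3 := mul_le_mul_of_nonneg_left h2 (mul_nonneg hδ.le hβ)
      nlinarith
    · set L := β + 3 * a ^ 2 with hL
      -- The leading slack is a z² with z = u - 1/2, and the first-order term is its value at z = 0
      -- plus z k with |k| ≤ L. Completing the square absorbs δ z k at a cost of δ²L²/(4a).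
      refine ⟨L ^ 2 / (4 * a), γ / 2 - β / 16 - a ^ 2 / 16, by linarith [h1 ha], by positivity,
        fun δ u hδ hu0 hu1 => ?_⟩
      set z := u - 1 / 2 with hz
      have hfac : (β * (1 - u) ^ 2 / 2 - a ^ 2 * (1 - u) ^ 2 / 2 - a ^ 2 * u * (1 - u)) * u +
          a ^ 2 * (1 - u) / 2 = β / 16 + a ^ 2 / 16 + z * ((β - a ^ 2) / 2 *
            (u ^ 2 - 3 / 2 * u + 1 / 4) - a ^ 2 * (-u ^ 2 + u / 2 + 1 / 4) - a ^ 2 / 2) := by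
        rw [hz]; ring
      have hb1 : |u ^ 2 - 3 / 2 * u + 1 / 4| ≤ 1 := abs_le.2 ⟨by nlinarith, by nlinarith⟩
      have hb2 : |-u ^ 2 + u / 2 + 1 / 4| ≤ 1 := abs_le.2 ⟨by nlinarith, by nlinarith⟩
      have hK : |(β - a ^ 2) / 2 * (u ^ 2 - 3 / 2 * u + 1 / 4) -
          a ^ 2 * (-u ^ 2 + u / 2 + 1 / 4) - a ^ 2 / 2| ≤ L := by
        have e1 : |(β - a ^ 2) / 2 * (u ^ 2 - 3 / 2 * u + 1 / 4)| ≤ (β + a ^ 2) / 2 * 1 := by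
          rw [abs_mul]
          refine mul_le_mul ?_ hb1 (abs_nonneg _) (by positivity)
          rw [abs_le]; constructor <;> nlinarith [sq_nonneg a]
        have e2 : |a ^ 2 * (-u ^ 2 + u / 2 + 1 / 4)| ≤ a ^ 2 * 1 := by
          rw [abs_mul, abs_of_nonneg (sq_nonneg a)]
          exact mul_le_mul_of_nonneg_left hb2 (sq_nonneg a)
        have e3 : |a ^ 2 / 2| = a ^ 2 / 2 := abs_of_nonneg (by positivity)
        refine (abs_sub _ _).trans ((add_le_add_left (abs_sub _ _) _).trans ?_)
        rw [e3]
        nlinarith [sq_nonneg a]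
      rw [hfac]
      set k := (β - a ^ 2) / 2 * (u ^ 2 - 3 / 2 * u + 1 / 4) -
          a ^ 2 * (-u ^ 2 + u / 2 + 1 / 4) - a ^ 2 / 2
      have hkk : k ^ 2 ≤ L ^ 2 := sq_le_sq' (abs_le.1 hK).1 (abs_le.1 hK).2
      have hsq : 0 ≤ (2 * a * z - δ * k) ^ 2 / (4 * a) := by positivity
      have hsq' : (2 * a * z - δ * k) ^ 2 / (4 * a) =
          a * z ^ 2 - δ * (z * k) + δ ^ 2 * (k ^ 2 / (4 * a)) := by
        field_simp; ring
      have hk4 : δ ^ 2 * (k ^ 2 / (4 * a)) ≤ δ ^ 2 * (L ^ 2 / (4 * a)) := by gcongr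
      have haz : a / 4 - a * (1 - u) * u = a * z ^ 2 := by rw [hz]; ring
      rw [hsq'] at hsq
      linarith
  refine ⟨min 1 (κ / (K + C + 1)), lt_min one_pos (by positivity), fun δ hδ hlt u hu0 hu1 => ?_⟩
  have hδ1 : δ < 1 := hlt.trans_le (min_le_left _ _)
  have hδ2 : δ * (K + C + 1) < κ := (lt_div_iff₀ (by positivity)).1
    (hlt.trans_le (min_le_right _ _))
  have hm := hmain δ u hδ hu0 hu1
  set q := β * (1 - u) ^ 2 / 2 - a ^ 2 * (1 - u) ^ 2 / 2 - a ^ 2 * u * (1 - u) with hq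
  have hw : (1 - u) ^ 2 ≤ 1 := by nlinarith
  have hq1 : q ≤ β / 2 := by
    have e1 : 0 ≤ a ^ 2 * (1 - u) ^ 2 / 2 := by positivity
    have e2 : 0 ≤ a ^ 2 * u * (1 - u) := mul_nonneg (by positivity) (by linarith)
    have e3 := mul_le_mul_of_nonneg_left hw hβ
    linarith
  have hS : γ * a * (1 - u) + q * (a / 2 + γ * δ) ≤ C := by
    have e1 : q * (a / 2 + γ * δ) ≤ β / 2 * (a / 2 + γ * δ) :=
      mul_le_mul_of_nonneg_right hq1 (by positivity)
    have e2 : β / 2 * (a / 2 + γ * δ) ≤ β / 2 * (a / 2 + γ) := by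
      refine mul_le_mul_of_nonneg_left ?_ (by positivity)
      nlinarith
    have e3 : 0 ≤ γ * a * u := by positivity
    rw [hC]
    linarith
  have hS' := mul_le_mul_of_nonneg_left hS (sq_nonneg δ)
  have hκ' := mul_le_mul_of_nonneg_left hδ2.le hδ.le
  have hexp : (a * (1 - u) + δ * q) * (u + δ * (a / 2 + γ * δ)) = a * (1 - u) * u +
      δ * (q * u + a ^ 2 * (1 - u) / 2) + δ ^ 2 * (γ * a * (1 - u) + q * (a / 2 + γ * δ)) := by
    ring
  rw [hexp]
  linarith [sq_nonneg δ]

/-- For small `δ`, the lower bound on the gain from search exceeds its expansion with a smaller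
coefficient `γ` of the third order. -/
lemma eventually_lt_expansion {a β₁ β₂ γ : ℝ} (h : γ < β₁ / 6 - a ^ 2 / 3) :
    ∀ᶠ δ in 𝓝[>] (0 : ℝ), a * δ ^ 2 / 2 + γ * δ ^ 3 <
      (1 - a * δ - β₂ * δ ^ 2 / 2) * (a * δ ^ 2 / 2 + β₁ * δ ^ 3 / 6) +
        a / 2 * (a * δ ^ 3 / 3 + β₁ * δ ^ 4 / 12) := by
  -- This is minus the sum of the terms of order four and five on the right, divided by δ³.
  have hc : Continuous fun δ : ℝ => δ * (a * β₁ / 6 + β₂ * a / 4 + δ * β₂ * β₁ / 12 -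
      a * β₁ / 24) := by fun_prop
  have ht := hc.tendsto 0
  simp only [zero_mul] at ht
  filter_upwards [nhdsWithin_le_nhds (ht.eventually (gt_mem_nhds (sub_pos.2 h))),
    self_mem_nhdsWithin] with δ h1 h2
  have h3 := mul_lt_mul_of_pos_left h1 (pow_pos h2 3)
  linarith

/-! ### Expansions near V under linear bounds on the density. -/

section Density

set_option linter.unusedSectionVars false

variable {μ : Measure ℝ} [IsProbabilityMeasure μ] {V : ℝ} {f : ℝ → ℝ} {a β₁ β₂ η : ℝ}

/-- The measure has a density that lies between `a + β₁ s` and `a + β₂ s` at `V + s`, for small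
`s`. -/
structure HasDensityBounds (μ : Measure ℝ) (V : ℝ) (f : ℝ → ℝ) (a β₁ β₂ η : ℝ) : Prop where
  measurable : Measurable f
  eq_withDensity : μ = volume.withDensity fun x => ENNReal.ofReal (f x)
  nonneg : ∀ x, 0 ≤ f x
  lower : ∀ s, 0 < s → s < η → a + β₁ * s ≤ f (V + s)
  upper : ∀ s, 0 < s → s < η → f (V + s) ≤ a + β₂ * s

namespace HasDensityBounds

lemma setIntegral_eq (h : HasDensityBounds μ V f a β₁ β₂ η) (s : Set ℝ) (hs : MeasurableSet s)
    (φ : ℝ → ℝ) : ∫ v in s, φ v ∂μ = ∫ v in s, f v * φ v := by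
  rw [h.eq_withDensity, setIntegral_withDensity_eq_setIntegral_toReal_smul
    h.measurable.ennreal_ofReal (ae_of_all _ fun _ => ENNReal.ofReal_lt_top) _ hs]
  simp [ENNReal.toReal_ofReal (h.nonneg _)]

lemma integrableOn_mul (h : HasDensityBounds μ V f a β₁ β₂ η) {x y : ℝ} (hx : 0 ≤ x) (hy : y < η)
    {φ : ℝ → ℝ} (hφ : Continuous φ) (hφ0 : ∀ s, x < s → s ≤ y → 0 ≤ φ s) :
    IntegrableOn (fun v => f v * φ (v - V)) (Ioc (V + x) (V + y)) := by
  refine Integrable.mono' (g := fun v => (a + β₂ * (v - V)) * φ (v - V))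
    ((by fun_prop : Continuous fun v => (a + β₂ * (v - V)) * φ (v - V)).integrableOn_Ioc)
    (h.measurable.mul (by fun_prop)).aestronglyMeasurable
    ((ae_restrict_mem measurableSet_Ioc).mono fun v hv => ?_)
  have h0 := hφ0 (v - V) (by linarith [hv.1]) (by linarith [hv.2])
  have h1 := h.upper (v - V) (by linarith [hv.1]) (by linarith [hv.2])
  rw [add_sub_cancel] at h1
  rw [Real.norm_of_nonneg (mul_nonneg (h.nonneg _) h0)]
  exact mul_le_mul_of_nonneg_right h1 h0

lemma setIntegral_shift {x y : ℝ} (hxy : x ≤ y) (ψ : ℝ → ℝ) :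
    ∫ v in Ioc (V + x) (V + y), ψ (v - V) = ∫ s in x..y, ψ s := by
  rw [← intervalIntegral.integral_of_le (by linarith),
    intervalIntegral.integral_comp_sub_right, add_sub_cancel_left, add_sub_cancel_left]

lemma setIntegral_le (h : HasDensityBounds μ V f a β₁ β₂ η) {x y : ℝ} (hx : 0 ≤ x) (hxy : x ≤ y)
    (hy : y < η) {φ : ℝ → ℝ} (hφ : Continuous φ) (hφ0 : ∀ s, x < s → s ≤ y → 0 ≤ φ s) :
    ∫ v in Ioc (V + x) (V + y), φ (v - V) ∂μ ≤ ∫ s in x..y, (a + β₂ * s) * φ s := by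
  rw [h.setIntegral_eq _ measurableSet_Ioc,
    ← setIntegral_shift (V := V) hxy fun s => (a + β₂ * s) * φ s]
  refine setIntegral_mono_on (h.integrableOn_mul hx hy hφ hφ0)
    ((by fun_prop : Continuous fun v => (a + β₂ * (v - V)) * φ (v - V)).integrableOn_Ioc)
    measurableSet_Ioc fun v hv => ?_
  have h1 := h.upper (v - V) (by linarith [hv.1]) (by linarith [hv.2])
  rw [add_sub_cancel] at h1
  exact mul_le_mul_of_nonneg_right h1 (hφ0 (v - V) (by linarith [hv.1]) (by linarith [hv.2]))

lemma le_setIntegral (h : HasDensityBounds μ V f a β₁ β₂ η) {x y : ℝ} (hx : 0 ≤ x) (hxy : x ≤ y)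
    (hy : y < η) {φ : ℝ → ℝ} (hφ : Continuous φ) (hφ0 : ∀ s, x < s → s ≤ y → 0 ≤ φ s) :
    ∫ s in x..y, (a + β₁ * s) * φ s ≤ ∫ v in Ioc (V + x) (V + y), φ (v - V) ∂μ := by
  rw [h.setIntegral_eq _ measurableSet_Ioc,
    ← setIntegral_shift (V := V) hxy fun s => (a + β₁ * s) * φ s]
  refine setIntegral_mono_on
    ((by fun_prop : Continuous fun v => (a + β₁ * (v - V)) * φ (v - V)).integrableOn_Ioc)
    (h.integrableOn_mul hx hy hφ hφ0) measurableSet_Ioc fun v hv => ?_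
  have h1 := h.lower (v - V) (by linarith [hv.1]) (by linarith [hv.2])
  rw [add_sub_cancel] at h1
  exact mul_le_mul_of_nonneg_right h1 (hφ0 (v - V) (by linarith [hv.1]) (by linarith [hv.2]))

lemma measureReal_Iic_eq (hs : ∀ᵐ v ∂μ, v ∈ Icc V (V + 1)) [NullSingletonClass μ] (y : ℝ) :
    μ.real (Iic (V + y)) = ∫ v in Ioc (V + 0) (V + y), (fun _ => (1 : ℝ)) (v - V) ∂μ := by
  rw [setIntegral_const, smul_eq_mul, mul_one, add_zero]
  have hne : ∀ᵐ v ∂μ, v ≠ V := by simp [ae_iff]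
  refine measureReal_congr ?_
  filter_upwards [hs, hne] with v hv hne
  exact propext ⟨fun h => ⟨lt_of_le_of_ne hv.1 (Ne.symm hne), h⟩, fun h => h.2⟩

lemma measureReal_Iic_le (hs : ∀ᵐ v ∂μ, v ∈ Icc V (V + 1)) [NullSingletonClass μ]
    (h : HasDensityBounds μ V f a β₁ β₂ η) {y : ℝ} (hy0 : 0 ≤ y) (hy : y < η) :
    μ.real (Iic (V + y)) ≤ a * y + β₂ * y ^ 2 / 2 := by
  rw [measureReal_Iic_eq hs]
  refine (h.setIntegral_le le_rfl hy0 hy continuous_const fun _ _ _ => zero_le_one).trans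
    (le_of_eq ?_)
  have := integral_cubic a β₂ 0 0 0 y
  simp only [zero_mul, add_zero] at this
  simp only [mul_one, this]
  ring

lemma le_measureReal_Iic (hs : ∀ᵐ v ∂μ, v ∈ Icc V (V + 1)) [NullSingletonClass μ]
    (h : HasDensityBounds μ V f a β₁ β₂ η) (hβ : 0 ≤ β₁) {y : ℝ} (hy0 : 0 ≤ y) (hy : y < η) :
    a * y ≤ μ.real (Iic (V + y)) := by
  rw [measureReal_Iic_eq hs]
  refine le_trans ?_ (h.le_setIntegral le_rfl hy0 hy continuous_const fun _ _ _ => zero_le_one)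
  have := integral_cubic a β₁ 0 0 0 y
  simp only [zero_mul, add_zero] at this
  simp only [mul_one, this]
  have : 0 ≤ β₁ * y ^ 2 := by positivity
  linarith

/-- A value above V + δ contributes exactly δ - s to the difference, and a value v between V + s and
V + δ contributes v - V - s. The density bounds then estimate the two masses. -/
lemma searchGain_sub_ge (hs : ∀ᵐ v ∂μ, v ∈ Icc V (V + 1)) [NullSingletonClass μ]
    (h : HasDensityBounds μ V f a β₁ β₂ η) (hβ : 0 ≤ β₁) {s δ : ℝ} (hs0 : 0 ≤ s) (hsδ : s ≤ δ)
    (hδ : δ < η) :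
    (δ - s) * (1 - a * δ - β₂ * δ ^ 2 / 2) + a / 2 * (δ - s) ^ 2 ≤
      searchGain μ (V + s) - searchGain μ (V + δ) := by
  have hi : IntegrableOn (fun v => v - V - s) (Ioc (V + s) (V + δ)) μ :=
    (integrable_of_continuous hs (by fun_prop)).integrableOn
  have h1 : ∫ v, ((Ioi (V + δ)).indicator (fun _ => δ - s) v +
      (Ioc (V + s) (V + δ)).indicator (fun v => v - V - s) v) ∂μ ≤
      searchGain μ (V + s) - searchGain μ (V + δ) := by
    rw [searchGain, searchGain, ← integral_sub (integrable_max_sub hs _) (integrable_max_sub hs _)]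
    refine integral_mono (((integrable_const _).indicator measurableSet_Ioi).add
      ((integrable_indicator_iff measurableSet_Ioc).2 hi))
      ((integrable_max_sub hs _).sub (integrable_max_sub hs _)) fun v => ?_
    simp only
    rcases le_or_gt v (V + δ) with hv | hv
    · rw [indicator_of_notMem (by simpa using hv), max_eq_right (by linarith : v - (V + δ) ≤ 0)]
      by_cases hv' : V + s < v
      · rw [indicator_of_mem (show v ∈ Ioc (V + s) (V + δ) from ⟨hv', hv⟩)]
        linarith [le_max_left (v - (V + s)) 0]
      · rw [indicator_of_notMem (fun hm => hv' hm.1)]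
        linarith [le_max_right (v - (V + s)) 0]
    · rw [indicator_of_mem (show v ∈ Ioi (V + δ) from hv),
        indicator_of_notMem (fun hm => absurd hm.2 (not_le.2 hv)),
        max_eq_left (by linarith : 0 ≤ v - (V + δ))]
      linarith [le_max_left (v - (V + s)) 0]
  rw [integral_add ((integrable_const _).indicator measurableSet_Ioi)
    ((integrable_indicator_iff measurableSet_Ioc).2 hi), integral_indicator measurableSet_Ioi,
    integral_indicator measurableSet_Ioc, setIntegral_const, smul_eq_mul, ← one_sub_cdf,
    cdf_eq_real] at h1
  have h2 := h.measureReal_Iic_le hs (hs0.trans hsδ) hδ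
  have h3 := h.le_setIntegral hs0 hsδ hδ (φ := fun u => u - s) (by fun_prop)
    fun u hu _ => by linarith
  have h4 : a / 2 * (δ - s) ^ 2 ≤ ∫ u in s..δ, (a + β₁ * u) * (u - s) := by
    have e : ∀ u, (a + β₁ * u) * (u - s) =
        -(a * s) + (a - β₁ * s) * u + β₁ * u ^ 2 + 0 * u ^ 3 := fun u => by ring
    simp_rw [e]
    rw [integral_cubic]
    have : 0 ≤ β₁ * ((δ - s) ^ 2 * (2 * δ + s)) :=
      mul_nonneg hβ (mul_nonneg (sq_nonneg _) (by linarith))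
    nlinarith
  have h5 : (δ - s) * (1 - a * δ - β₂ * δ ^ 2 / 2) ≤ (1 - μ.real (Iic (V + δ))) * (δ - s) := by
    rw [mul_comm]
    exact mul_le_mul_of_nonneg_right (by linarith) (by linarith)
  linarith

lemma le_integral_searchGain (hs : ∀ᵐ v ∂μ, v ∈ Icc V (V + 1)) [NullSingletonClass μ]
    (h : HasDensityBounds μ V f a β₁ β₂ η) (hβ : 0 ≤ β₁) (ha : 0 ≤ a) {δ : ℝ} (hδ0 : 0 ≤ δ)
    (hδ : δ < η) (hm : 0 ≤ 1 - a * δ - β₂ * δ ^ 2 / 2) :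
    (1 - a * δ - β₂ * δ ^ 2 / 2) * (a * δ ^ 2 / 2 + β₁ * δ ^ 3 / 6) +
        a / 2 * (a * δ ^ 3 / 3 + β₁ * δ ^ 4 / 12) ≤
      ∫ v, max (searchGain μ v - searchGain μ (V + δ)) 0 ∂μ := by
  set m := 1 - a * δ - β₂ * δ ^ 2 / 2
  have hg := continuous_searchGain hs
  have hi : Integrable (fun v => max (searchGain μ v - searchGain μ (V + δ)) 0) μ :=
    integrable_of_continuous hs (by fun_prop)
  have h1 := h.le_setIntegral le_rfl hδ0 hδ
    (φ := fun s => (δ - s) * m + a / 2 * (δ - s) ^ 2) (by fun_prop)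
    fun s _ hs => add_nonneg (mul_nonneg (by linarith) hm) (by positivity)
  have h2 : ∫ v in Ioc (V + 0) (V + δ), ((δ - (v - V)) * m + a / 2 * (δ - (v - V)) ^ 2) ∂μ ≤
      ∫ v in Ioc (V + 0) (V + δ), max (searchGain μ v - searchGain μ (V + δ)) 0 ∂μ := by
    refine setIntegral_mono_on (integrable_of_continuous hs
      (φ := fun v => (δ - (v - V)) * m + a / 2 * (δ - (v - V)) ^ 2) (by fun_prop)).integrableOn
      hi.integrableOn measurableSet_Ioc fun v hv => ?_
    have := h.searchGain_sub_ge hs hβ (s := v - V) (by linarith [hv.1]) (by linarith [hv.2]) hδ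
    rw [add_sub_cancel] at this
    exact this.trans (le_max_left _ _)
  have h3 := setIntegral_le_integral (s := Ioc (V + 0) (V + δ)) hi
    (ae_of_all _ fun v => le_max_right _ _)
  refine le_trans (le_of_eq ?_) (h1.trans (h2.trans h3))
  have e : ∀ s, (a + β₁ * s) * ((δ - s) * m + a / 2 * (δ - s) ^ 2) =
      a * (δ * m + a / 2 * δ ^ 2) + (β₁ * (δ * m + a / 2 * δ ^ 2) - a * (m + a * δ)) * s +
        (a * (a / 2) - β₁ * (m + a * δ)) * s ^ 2 + β₁ * (a / 2) * s ^ 3 := fun s => by ring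
  simp_rw [e]
  rw [integral_cubic]
  ring

/-- Integrate f(V + s) ≤ a + β₂s against 1 - F(V + s + x) ≤ 1 - a(s + x) and drop the cubic terms,
which are nonpositive. -/
lemma secondDemand_le_quadratic (hs : ∀ᵐ v ∂μ, v ∈ Icc V (V + 1)) [NullSingletonClass μ]
    (h : HasDensityBounds μ V f a β₁ β₂ η) (hβ : 0 ≤ β₁) (hβ₂ : 0 ≤ β₂) (ha : 0 ≤ a) {δ x : ℝ}
    (hx0 : 0 ≤ x) (hxδ : x ≤ δ) (hδ : δ < η) (haδ : a * δ ≤ 1) :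
    secondDemand μ (V + δ) x ≤ a * (δ - x) + β₂ * (δ - x) ^ 2 / 2 -
      a ^ 2 * ((δ - x) ^ 2 / 2 + x * (δ - x)) := by
  have hpos : ∀ s, s ≤ δ - x → 0 ≤ 1 - a * (s + x) := fun s hs => by
    have := mul_le_mul_of_nonneg_left (by linarith : s + x ≤ δ) ha
    linarith
  have h1 : secondDemand μ (V + δ) x ≤
      ∫ v in Ioc (V + 0) (V + (δ - x)), (1 - a * ((v - V) + x)) ∂μ := by
    rw [secondDemand_eq_integral, ← integral_indicator measurableSet_Ioc]
    have hne : ∀ᵐ v ∂μ, v ≠ V := by simp [ae_iff]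
    refine integral_mono_of_nonneg (ae_of_all _ fun v => ?_) ((integrable_of_continuous hs
      (φ := fun v => 1 - a * ((v - V) + x)) (by fun_prop)).indicator measurableSet_Ioc) ?_
    · simp only [Pi.zero_apply]
      split_ifs
      exacts [measureReal_nonneg, le_rfl]
    · filter_upwards [hs, hne] with v hv hne
      have hv' : V < v := lt_of_le_of_ne hv.1 (Ne.symm hne)
      by_cases hlt : v + x < V + δ
      · rw [if_pos hlt, indicator_of_mem
          (show v ∈ Ioc (V + 0) (V + (δ - x)) from ⟨by linarith, by linarith⟩),
          ← one_sub_cdf, cdf_eq_real]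
        have := h.le_measureReal_Iic hs hβ (y := v - V + x) (by linarith) (by linarith)
        rw [show V + (v - V + x) = v + x by ring] at this
        linarith
      · rw [if_neg hlt]
        exact indicator_nonneg (fun w hw => hpos _ (by linarith [hw.2])) v
  have h2 := h.setIntegral_le le_rfl (by linarith : 0 ≤ δ - x) (by linarith)
    (φ := fun s => 1 - a * (s + x)) (by fun_prop) fun s _ hs => hpos s hs
  refine h1.trans (h2.trans ?_)
  have e : ∀ s, (a + β₂ * s) * (1 - a * (s + x)) = a * (1 - a * x) +
      (β₂ * (1 - a * x) - a ^ 2) * s + -(β₂ * a) * s ^ 2 + 0 * s ^ 3 := fun s => by ring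
  simp_rw [e]
  rw [integral_cubic]
  have hy : 0 ≤ δ - x := by linarith
  have p1 : 0 ≤ β₂ * a * x * (δ - x) ^ 2 := by positivity
  have p2 : 0 ≤ β₂ * a * (δ - x) ^ 3 := by positivity
  nlinarith

/-- With r = aδ²/2 + γδ³ the claim reads D(x + r) ≤ r/2. Substituting x = uδ and dividing by δ²
leaves `hpoly`. -/
lemma mul_secondDemand_le (hs : ∀ᵐ v ∂μ, v ∈ Icc V (V + 1)) [NullSingletonClass μ]
    (h : HasDensityBounds μ V f a β₁ β₂ η) (hβ : 0 ≤ β₁) (hβ₂ : 0 ≤ β₂) (ha : 0 ≤ a) {γ δ x : ℝ}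
    (hγ : 0 ≤ γ) (hx0 : 0 ≤ x) (hxδ : x ≤ δ) (hδ0 : 0 < δ) (hδ : δ < η) (haδ : a * δ ≤ 1)
    (hpoly : ∀ u, 0 ≤ u → u ≤ 1 →
      (a * (1 - u) + δ * (β₂ * (1 - u) ^ 2 / 2 - a ^ 2 * (1 - u) ^ 2 / 2 - a ^ 2 * u * (1 - u))) *
        (u + δ * (a / 2 + γ * δ)) ≤ a / 4 + γ * δ / 2) :
    x * secondDemand μ (V + δ) x ≤
      (a * δ ^ 2 / 2 + γ * δ ^ 3) * (1 / 2 - secondDemand μ (V + δ) x) := by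
  have h1 := h.secondDemand_le_quadratic hs hβ hβ₂ ha hx0 hxδ hδ haδ
  obtain ⟨u, rfl⟩ : ∃ u, x = u * δ := ⟨x / δ, by field_simp⟩
  have hu0 : 0 ≤ u := nonneg_of_mul_nonneg_left hx0 hδ0
  have hu1 : u ≤ 1 := le_of_mul_le_mul_right (by linarith) hδ0
  have h2 := mul_le_mul_of_nonneg_left (hpoly u hu0 hu1) (sq_nonneg δ)
  have h3 := mul_le_mul_of_nonneg_right h1
    (by positivity : 0 ≤ u * δ + (a * δ ^ 2 / 2 + γ * δ ^ 3))
  linarith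

end HasDensityBounds

lemma exists_hasDensityBounds (hf_meas : Measurable f) (hf_nonneg : ∀ x, 0 ≤ f x)
    (hμ : μ = volume.withDensity fun x => ENNReal.ofReal (f x)) {b : ℝ}
    (hf_diff : ∀ᶠ x in 𝓝[>] V, DifferentiableAt ℝ f x) (hf₀ : Tendsto f (𝓝[>] V) (𝓝 a))
    (hf₁ : Tendsto (deriv f) (𝓝[>] V) (𝓝 b)) (h₁ : β₁ < b) (h₂ : b < β₂) :
    ∃ η > 0, HasDensityBounds μ V f a β₁ β₂ η := by
  classical
  -- The value f(V) is arbitrary. Replaced by the right limit, it gives a function with right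
  -- derivative b at V, whose slopes lie between β₁ and β₂ nearby.
  set F := Function.update f V a with hF
  have hFf : ∀ x, V < x → F =ᶠ[𝓝 x] f := fun x hx => by
    filter_upwards [lt_mem_nhds hx] with y hy
    exact Function.update_of_ne (ne_of_gt hy) _ _
  have hFd : HasDerivWithinAt F b (Ici V) V := by
    obtain ⟨s, hs, hsd⟩ := hf_diff.exists_mem
    refine hasDerivWithinAt_Ici_of_tendsto_deriv (s := s ∩ Ioi V) (fun x hx => ?_) ?_
      (inter_mem hs self_mem_nhdsWithin) (hf₁.congr' ?_)
    · exact ((hFf x hx.2).differentiableAt_iff.2 (hsd x hx.1)).differentiableWithinAt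
    · rw [ContinuousWithinAt, hF, Function.update_self]
      refine ((hf₀.congr' ?_)).mono_left (nhdsWithin_mono V inter_subset_right)
      filter_upwards [self_mem_nhdsWithin] with x hx
      exact (hFf x hx).eq_of_nhds.symm
    · filter_upwards [self_mem_nhdsWithin] with x hx
      exact (hFf x hx).deriv_eq.symm
  have hslope := (hasDerivWithinAt_iff_tendsto_slope' self_notMem_Ioi).1 hFd.Ioi_of_Ici
  have hev := (hslope.eventually (lt_mem_nhds h₁)).and (hslope.eventually (gt_mem_nhds h₂))
  obtain ⟨u, hu, hsub⟩ := (mem_nhdsGT_iff_exists_Ioo_subset).1 hev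
  have key : ∀ s, 0 < s → s < u - V → β₁ < (f (V + s) - a) / s ∧ (f (V + s) - a) / s < β₂ := by
    intro s h0 h1
    have hm := hsub (show V + s ∈ Ioo V u from ⟨by linarith, by linarith⟩)
    have e : slope F V (V + s) = (f (V + s) - a) / s := by
      rw [slope_def_field, (hFf (V + s) (by linarith)).eq_of_nhds, hF, Function.update_self,
        add_sub_cancel_left]
    rw [← e]
    exact hm
  refine ⟨u - V, sub_pos.2 hu, hf_meas, hμ, hf_nonneg, fun s h0 h1 => ?_, fun s h0 h1 => ?_⟩
  · linarith [(lt_div_iff₀ h0).1 (key s h0 h1).1]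
  · linarith [(div_lt_iff₀ h0).1 (key s h0 h1).2]

/-- For a > 0, γ is the midpoint of b/8 + a²/8 and b/6 - a²/3, and the slopes differ from b by the
half-gap (b - 11a²)/48. For a = 0, γ is the midpoint of 4β₂/27 and β₁/6. -/
lemma exists_slopes {a b : ℝ} (ha : 0 ≤ a) (hb : a ^ 2 < 1 / 13 * b) :
    ∃ β₁ β₂ γ : ℝ, 0 ≤ β₁ ∧ β₁ < b ∧ b < β₂ ∧ 0 ≤ γ ∧ γ < β₁ / 6 - a ^ 2 / 3 ∧
      (a = 0 → 4 / 27 * β₂ < γ) ∧ (0 < a → β₂ / 8 + a ^ 2 / 8 < γ) := by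
  have hb0 : 0 < b := by nlinarith [sq_nonneg a]
  rcases ha.eq_or_lt with rfl | ha
  · refine ⟨b * (35 / 36), b * (33 / 32), b * (17 / 108), ?_, ?_, ?_, ?_, ?_, fun _ => ?_,
      fun h => absurd h (lt_irrefl _)⟩ <;> linarith
  · refine ⟨b - (b - 11 * a ^ 2) / 48, b + (b - 11 * a ^ 2) / 48, 7 * b / 48 - 5 * a ^ 2 / 48,
      ?_, ?_, ?_, ?_, ?_, fun h => absurd h ha.ne', fun _ => ?_⟩ <;> nlinarith [sq_nonneg a]

/-- For costs slightly below the maximal one, the gain from search exceeds the lowest price. -/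
lemma eventually_integral_lt_surplusAtTStar (hs : ∀ᵐ v ∂μ, v ∈ Icc V (V + 1))
    [NullSingletonClass μ] (hV : 1 ≤ V) (hf_meas : Measurable f) (hf_nonneg : ∀ x, 0 ≤ f x)
    (hμ : μ = volume.withDensity fun x => ENNReal.ofReal (f x)) {b : ℝ}
    (hf_diff : ∀ᶠ x in 𝓝[>] V, DifferentiableAt ℝ f x) (hf₀ : Tendsto f (𝓝[>] V) (𝓝 a))
    (hf₁ : Tendsto (deriv f) (𝓝[>] V) (𝓝 b)) (hab : a ^ 2 < 1 / 13 * b) :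
    ∀ᶠ c in 𝓝[<] (cBar μ V), ∫ v, v ∂μ < surplusAtTStar μ V c := by
  have ha : 0 ≤ a := ge_of_tendsto' hf₀ fun x => hf_nonneg x
  obtain ⟨β₁, β₂, γ, hβ₁, h₁, h₂, hγ, hlt, hz, hp⟩ := exists_slopes ha hab
  have hβ₂ : 0 ≤ β₂ := by linarith
  obtain ⟨η, hη, h⟩ := exists_hasDensityBounds hf_meas hf_nonneg hμ hf_diff hf₀ hf₁ h₁ h₂
  obtain ⟨δ₀, hδ₀, hpoly⟩ := exists_forall_scaled_le ha hβ₂ hγ hz hp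
  have hm : ∀ᶠ δ in 𝓝[>] (0 : ℝ), 0 < 1 - a * δ - β₂ * δ ^ 2 / 2 := by
    have hc : Continuous fun δ : ℝ => 1 - a * δ - β₂ * δ ^ 2 / 2 := by fun_prop
    exact nhdsWithin_le_nhds ((hc.tendsto 0).eventually (lt_mem_nhds (by norm_num)))
  have ht : Tendsto (fun c => theta0 μ c - V) (𝓝[<] (cBar μ V)) (𝓝[>] 0) := by
    refine tendsto_nhdsWithin_iff.2 ⟨?_, ?_⟩
    · have := ((tendsto_theta0_cBar hs).mono_right nhdsWithin_le_nhds).sub_const V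
      rwa [sub_self] at this
    · filter_upwards [(tendsto_theta0_cBar hs).eventually self_mem_nhdsWithin] with c hc
      exact sub_pos.2 hc
  filter_upwards [ht.eventually (eventually_lt_expansion (β₂ := β₂) hlt), ht.eventually hm,
    ht.eventually self_mem_nhdsWithin,
    ht.eventually (nhdsWithin_le_nhds (gt_mem_nhds (lt_min hη hδ₀))), self_mem_nhdsWithin,
    nhdsWithin_le_nhds (lt_mem_nhds (cBar_pos hs))] with c e1 e2 e3 e4 e5 e6
  have e6 : 0 < c := e6
  have e3 : 0 < theta0 μ c - V := e3
  have e4η := e4.trans_le (min_le_left _ _)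
  have e4δ := e4.trans_le (min_le_right _ _)
  have hθ : V + (theta0 μ c - V) = theta0 μ c := by ring
  have hgain := h.le_integral_searchGain hs hβ₁ ha e3.le e4η e2.le
  rw [hθ, searchGain_theta0 hs e6.le] at hgain
  have haδ : a * (theta0 μ c - V) ≤ 1 := by
    have : 0 ≤ β₂ * (theta0 μ c - V) ^ 2 := by positivity
    linarith
  have htS : tStar μ V c ≤ a * (theta0 μ c - V) ^ 2 / 2 + γ * (theta0 μ c - V) ^ 3 := by
    refine tStar_le hs fun x hx => ?_
    rcases le_or_gt (theta0 μ c - V) x with hx1 | hx1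
    · rw [secondDemand_eq_zero hs hx1]
      have : 0 ≤ a * (theta0 μ c - V) ^ 2 / 2 + γ * (theta0 μ c - V) ^ 3 := by positivity
      linarith
    · have := h.mul_secondDemand_le hs hβ₁ hβ₂ ha hγ hx.le hx1.le e3 e4η haδ
        (hpoly _ e3 e4δ)
      rwa [hθ] at this
  rw [surplusAtTStar_eq hs hV ⟨e6.le, le_of_lt e5⟩, searchWelfare]
  linarith

end Density

end ProminenceMarket

/-! ### The main theorem. -/

theorem mainTheorem11 (V : ℝ) (hV : 2 ≤ V)
    (f : ℝ → ℝ) (hf_meas : Measurable f) (hf_nonneg : ∀ x, 0 ≤ f x)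
    (hf_supp : ∀ x, x ∉ Set.Icc V (V + 1) → f x = 0)
    (μ : MeasureTheory.Measure ℝ) [MeasureTheory.IsProbabilityMeasure μ]
    (hμ : μ = MeasureTheory.volume.withDensity fun x => ENNReal.ofReal (f x))
    (f₀ f₁ : ℝ)
    (hf_diff : ∀ᶠ x in 𝓝[>] V, DifferentiableAt ℝ f x)
    (hf₀ : Filter.Tendsto f (𝓝[>] V) (𝓝 f₀))
    (hf₁ : Filter.Tendsto (deriv f) (𝓝[>] V) (𝓝 f₁))
    (hcond : f₀ ^ 2 < 1 / 13 * f₁) :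
    -- the surplus at the lowest price is welfare minus that price
    (∀ c ∈ Set.Icc 0 (ProminenceMarket.cBar μ V),
      ProminenceMarket.surplusAtTStar μ V c =
        ProminenceMarket.welfareAtTStar μ V c - ProminenceMarket.tStar μ V c) ∧
    -- it bounds every surplus achievable at a symmetric equilibrium of a standard mechanism
    (∀ c ∈ Set.Ioo 0 (ProminenceMarket.cBar μ V),
      ProminenceMarket.surplusAtTStar μ V c ∈
        upperBounds (ProminenceMarket.achievableSurplus μ c)) ∧
    -- its limits at the two ends of the range of costs
    Filter.Tendsto (ProminenceMarket.surplusAtTStar μ V) (𝓝[>] 0)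
      (𝓝 (ProminenceMarket.surplusAtTStar μ V 0)) ∧
    Filter.Tendsto (ProminenceMarket.surplusAtTStar μ V) (𝓝[<] (ProminenceMarket.cBar μ V))
      (𝓝 (∫ v, v ∂μ)) ∧
    -- costs slightly below the maximal one are strictly better than the limit there, and the
    -- surplus in question is the highest one achieved at equilibrium
    (∀ᶠ c in 𝓝[<] (ProminenceMarket.cBar μ V),
      IsLeast (ProminenceMarket.implementablePrices μ c) (ProminenceMarket.tStar μ V c) ∧
      IsGreatest (ProminenceMarket.achievableSurplus μ c)
        (ProminenceMarket.surplusAtTStar μ V c) ∧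
      ∫ v, v ∂μ < ProminenceMarket.surplusAtTStar μ V c) ∧
    -- the maximum is attained, and not at the maximal cost
    (∃ c' ∈ Set.Ico 0 (ProminenceMarket.cBar μ V),
      (∀ c ∈ Set.Icc 0 (ProminenceMarket.cBar μ V),
        ProminenceMarket.surplusAtTStar μ V c ≤ ProminenceMarket.surplusAtTStar μ V c') ∧
      ∫ v, v ∂μ < ProminenceMarket.surplusAtTStar μ V c') := by
  have hs : ∀ᵐ v ∂μ, v ∈ Icc V (V + 1) := by
    have h0 : μ (Icc V (V + 1))ᶜ = 0 := by
      rw [hμ, withDensity_apply _ measurableSet_Icc.compl]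
      refine (setLIntegral_congr_fun measurableSet_Icc.compl fun x hx => ?_).trans
        (lintegral_zero (μ := volume.restrict (Icc V (V + 1))ᶜ))
      simp [hf_supp x hx]
    exact mem_ae_iff.2 h0
  have hna : NullSingletonClass μ := ⟨fun x => by
    rw [hμ]; exact withDensity_absolutelyContinuous _ _ (measure_singleton x)⟩
  have hV1 : 1 ≤ V := by linarith
  have hlt := ProminenceMarket.eventually_integral_lt_surplusAtTStar hs hV1 hf_meas hf_nonneg hμ
    hf_diff hf₀ hf₁ hcond
  refine ⟨fun c hc => ?_, fun c hc => ProminenceMarket.surplusAtTStar_mem_upperBounds hs hV hc,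
    ProminenceMarket.tendsto_surplusAtTStar_zero hs hV1,
    ProminenceMarket.tendsto_surplusAtTStar_cBar hs hV1, ?_,
    ProminenceMarket.exists_isMax_surplusAtTStar hs hV1 hlt⟩
  · rw [ProminenceMarket.surplusAtTStar_eq hs hV1 hc, ProminenceMarket.welfareAtTStar_eq hs hV1 hc]
  · filter_upwards [ProminenceMarket.eventually_isLeast_and_isGreatest hs hV, hlt] with c h1 h2
    exact ⟨h1.1, h1.2, h2⟩
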